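/- **Setting.** All outcomes are $\pm1$ and all numbers of settings are finite. A behaviour of $N$ parties is a tensor $P(\vec a|\vec x)$; it is *quantum* if $P(\vec a|\vec x)=\mathrm{Tr}\big(\rho\,\bigotimes_k A^{(k)}_{a_k|x_k}\big)$ for POVMs $A^{(k)}$ on complex Hilbert spaces and a density operator $\rho$ on their tensor product, and *classical* if $P(\vec a|\vec x)=\int\prod_k r_k(a_k|x_k,\lambda)\,d\mu(\lambda)$ for a probability measure $\mu$ and conditional distributions $r_k$. A (normalized) $q\to1$ connector, $q\ge1$, is a real tensor ${\sf C}_{b|y}^{\vec a|\vec x}$ such that the operators ${\sf C}_{b|y}[A]=\sum_{\vec a,\vec x}{\sf C}_{b|y}^{\vec a|\vec x}\bigotimes_kA^{(k)}_{a_k|x_k}$ form POVMs (one for each $y$) for all systems $A$ of POVMs. Put ${\sf C}_y=\sum_b b\,{\sf C}_{b|y}$ and $\langle {\sf C}_y\rangle_P=\sum_{b,\vec a,\vec x}b\,{\sf C}^{\vec a|\vec x}_{b|y}P(\vec a|\vec x)$. The connector is *XOR* if ${\sf C}_y[A]=\sum_{\vec x}c_{y,\vec x}\bigotimes_kK^{(k)}_{x_k}$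 for all $A$, with real coefficients $c_{y,\vec x}$ and $K^{(k)}_x=A^{(k)}_{+1|x}-A^{(k)}_{-1|x}$. An *XOR complex* $\mathcal C=({\sf C},\bar A,V)$ consists of an XOR connector ${\sf C}$, POVM systems $\bar A^{(k)}$ on Hilbert spaces $H_k$, and a coisometry $V:\bigotimes_kH_k\to H$ onto a Hilbert space $H\neq0$ such that the operators $\bar M_{b|y}=V{\sf C}_{b|y}[\bar A]V^\dagger$ are projectors with $\sum_b\bar M_{b|y}=\mathbb I$. The contraction of the output leg of $\mathcal C'$ with the $k$-th input leg of $\mathcal C$ is *congruent* if $\bar M(\mathcal C')=\bar A^{(k)}(\mathcal C)$ (up to a unitary identification of the two Hilbert spaces). For an XOR connector, $\gamma({\sf C})$ is the largest number with $-1\le\gamma({\sf C})\langle{\sf C}_y\rangle_P\le1$ for all $y$ and all classical $P$. **Proposition.** Let ${\sf C}$ be the tensor obtained by contracting, along a rooted tree, the connectors of XOR complexes $\mathcal C^1,\dots,\mathcal C^{n_c}$, all contractions being congruent; let $N$ be the number of uncontracted input legs and let $y$ be a setting of the root's output leg. Then 1. $-1\le\langle{\sf C}_y\rangle_P\le1$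 for all quantum behaviours $P$, and both bounds are attained by quantum behaviours; 2. every $\gamma({\sf C}(\mathcal C^k))$ exists (the maximum defining it is attained), and, with $\Gamma=\prod_{k=1}^{n_c}\gamma({\sf C}(\mathcal C^k))$, one has $-\frac1\Gamma\le\langle{\sf C}_y\rangle_P\le\frac1\Gamma$ for all classical behaviours $P$. **Corollary.** If $\gamma({\sf C}(\mathcal C^k))\ge\gamma_0>1$ for all $k$, then $\sup_{P\text{ classical}}\langle{\sf C}_y\rangle_P\le\gamma_0^{-n_c}$, and the quotient of the maximal quantum and the maximal classical value of ${\sf C}_y$ is at least $\gamma_0^{n_c}$. If moreover every $\mathcal C^k$ has at most $\bar q\ge2$ input legs, then $n_c\ge\big\lceil\frac{N-1}{\bar q-1}\big\rceil$, so this quotient is at least $\gamma_0^{(N-1)/(\bar q-1)}$, i.e. it grows at least exponentially with $N$. -/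

import Mathlib

/-! ### Hilbert space tensor products of finitely many factors -/

section HilbertTensor

open scoped ComplexOrder InnerProductSpace ComplexConjugate

universe u

theorem posSemidef_gram_of_any {n E : Type*} [NormedAddCommGroup E]
    [InnerProductSpace ℂ E] (v : n → E) : (Matrix.gram ℂ v).PosSemidef := by
  refine ⟨Matrix.isHermitian_gram ℂ v, fun c => ?_⟩
  have h : (c.sum fun i xi => c.sum fun j xj => star xi * Matrix.gram ℂ v i j * xj)
      = ⟪c.sum fun i r => r • v i, c.sum fun i r => r • v i⟫_ℂ := by
    simp only [Finsupp.sum, Matrix.gram_apply]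
    rw [sum_inner]
    refine Finset.sum_congr rfl fun i _ => ?_
    rw [inner_sum]
    refine Finset.sum_congr rfl fun j _ => ?_
    rw [inner_smul_left, inner_smul_right]
    simp only [RCLike.star_def]
    ring
  rw [h, inner_self_eq_norm_sq_to_K]
  positivity

theorem posSemidef_prod {n κ : Type*} (s : Finset κ) (G : κ → Matrix n n ℂ)
    (hG : ∀ k, (G k).PosSemidef) : (Matrix.of fun x y => ∏ k ∈ s, G k x y).PosSemidef := by
  classical
  induction s using Finset.induction_on with
  | empty =>
    have e : (Matrix.of fun x y => ∏ k ∈ (∅ : Finset κ), G k x y)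
        = Matrix.gram ℂ (fun _ : n => (1 : ℂ)) := by ext x y; simp
    rw [e]
    exact posSemidef_gram_of_any _
  | insert a s ha ih =>
    have e : (Matrix.of fun x y => ∏ k ∈ insert a s, G k x y)
        = (G a).hadamard (Matrix.of fun x y => ∏ k ∈ s, G k x y) := by
      ext x y; simp [Finset.prod_insert ha]
    rw [e]
    exact (hG a).hadamard ih

theorem posSemidef_prod_sub_prod {n κ : Type*} (s : Finset κ) (F G : κ → Matrix n n ℂ)
    (hF : ∀ k, (F k).PosSemidef) (hG : ∀ k, (G k).PosSemidef) (h : ∀ k, (F k - G k).PosSemidef) :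
    (Matrix.of fun x y => ∏ k ∈ s, F k x y - ∏ k ∈ s, G k x y).PosSemidef := by
  classical
  induction s using Finset.induction_on with
  | empty =>
    have e : (Matrix.of fun x y => ∏ k ∈ (∅ : Finset κ), F k x y - ∏ k ∈ (∅ : Finset κ), G k x y)
        = (0 : Matrix n n ℂ) := by ext x y; simp
    rw [e]
    exact Matrix.PosSemidef.zero
  | insert a s ha ih =>
    have e : (Matrix.of fun x y => ∏ k ∈ insert a s, F k x y - ∏ k ∈ insert a s, G k x y)
        = (F a - G a).hadamard (Matrix.of fun x y => ∏ k ∈ s, F k x y)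
          + (G a).hadamard (Matrix.of fun x y => ∏ k ∈ s, F k x y - ∏ k ∈ s, G k x y) := by
      ext x y; simp [Finset.prod_insert ha]; ring
    rw [e]
    exact ((h a).hadamard (posSemidef_prod s F hF)).add ((hG a).hadamard ih)

variable {ι : Type} [Fintype ι]

/-- The kernel `(x, y) ↦ ∏ₖ ⟪xₖ, yₖ⟫` on `∏ₖ Hₖ`. -/
noncomputable def tensorKernel (H : ι → Type u) [∀ k, NormedAddCommGroup (H k)]
    [∀ k, InnerProductSpace ℂ (H k)] : Matrix (∀ k, H k) (∀ k, H k) ℂ :=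
  Matrix.of fun x y => ∏ k, ⟪x k, y k⟫_ℂ

theorem posSemidef_tensorKernel (H : ι → Type u) [∀ k, NormedAddCommGroup (H k)]
    [∀ k, InnerProductSpace ℂ (H k)] : (tensorKernel H).PosSemidef :=
  posSemidef_prod Finset.univ (fun k => Matrix.gram ℂ fun x : ∀ k, H k => x k)
    fun _ => posSemidef_gram_of_any _

/-- The free vector space on the tuples `x ∈ ∏ₖ Hₖ`, with the semi-inner product determined by
`⟪x, y⟫ = ∏ₖ ⟪xₖ, yₖ⟫`. Its quotient by the null vectors is the algebraic tensor product. -/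
abbrev PreTensor (H : ι → Type u) : Type u := (∀ k, H k) →₀ ℂ

namespace PreTensor

variable (H : ι → Type u) [∀ k, NormedAddCommGroup (H k)] [∀ k, InnerProductSpace ℂ (H k)]

noncomputable instance core : PreInnerProductSpace.Core ℂ (PreTensor H) where
  inner f g := f.sum fun x r => g.sum fun y s => star r * tensorKernel H x y * s
  conj_inner_symm f g := by
    rw [Finsupp.sum_comm]
    simp only [map_finsuppSum]
    refine Finsupp.sum_congr fun x _ => Finsupp.sum_congr fun y _ => ?_
    rw [← (posSemidef_tensorKernel H).isHermitian.apply]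
    simp [mul_comm, mul_left_comm]
  re_inner_nonneg f := (Complex.le_def.1 ((posSemidef_tensorKernel H).2 f)).1
  add_left f g h := by
    rw [Finsupp.sum_add_index'] <;> simp [← Finsupp.sum_add, add_mul]
  smul_left f g r := by
    rw [Finsupp.sum_smul_index] <;> simp [Finsupp.mul_sum, ← mul_assoc]

noncomputable instance instSeminormedAddCommGroup : SeminormedAddCommGroup (PreTensor H) :=
  InnerProductSpace.Core.toSeminormedAddCommGroup (𝕜 := ℂ)

noncomputable instance instInnerProductSpace : InnerProductSpace ℂ (PreTensor H) := .ofCore _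

theorem inner_def (f g : PreTensor H) :
    ⟪f, g⟫_ℂ = f.sum fun x r => g.sum fun y s => star r * tensorKernel H x y * s := rfl

end PreTensor

/-- The Hilbert space tensor product `⨂ₖ Hₖ`: the completion of the above. By `tmul_update_add`,
`tmul_update_smul`, `inner_tmul` and `dense_span_tmul` below it is generated by a multilinear map
`tmul` with `⟪⨂ₖ xₖ, ⨂ₖ yₖ⟫ = ∏ₖ ⟪xₖ, yₖ⟫`, which determines it up to a unique unitary. -/
abbrev HilbertTensor (H : ι → Type u) [∀ k, NormedAddCommGroup (H k)]
    [∀ k, InnerProductSpace ℂ (H k)] : Type u :=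
  UniformSpace.Completion (PreTensor H)

namespace HilbertTensor

variable {H G : ι → Type u} [∀ k, NormedAddCommGroup (H k)] [∀ k, InnerProductSpace ℂ (H k)]
  [∀ k, NormedAddCommGroup (G k)] [∀ k, InnerProductSpace ℂ (G k)]

/-- The pure tensor `⨂ₖ xₖ`. -/
noncomputable def tmul (x : ∀ k, H k) : HilbertTensor H :=
  ((Finsupp.single x 1 : PreTensor H) : UniformSpace.Completion (PreTensor H))

theorem inner_tmul (x y : ∀ k, H k) : ⟪tmul x, tmul y⟫_ℂ = ∏ k, ⟪x k, y k⟫_ℂ := by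
  rw [tmul, tmul, UniformSpace.Completion.inner_coe, PreTensor.inner_def]
  simp [tensorKernel]

theorem coe_eq_sum (f : PreTensor H) :
    (f : HilbertTensor H) = f.sum fun x r => r • tmul x := by
  have h2 : UniformSpace.Completion.toComplₗᵢ (𝕜 := ℂ) (E := PreTensor H) f
      = UniformSpace.Completion.toComplₗᵢ (𝕜 := ℂ) (E := PreTensor H)
        (f.sum fun x r => r • Finsupp.single x (1 : ℂ)) := by
    congr 1
    conv_lhs => rw [← Finsupp.sum_single f]
    exact Finsupp.sum_congr fun x _ => (Finsupp.smul_single_one x _).symm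
  rw [map_finsuppSum] at h2
  simp only [map_smul] at h2
  exact h2

theorem dense_span_tmul :
    Dense (Submodule.span ℂ (Set.range (tmul (H := H))) : Set (HilbertTensor H)) := by
  refine UniformSpace.Completion.denseRange_coe.mono ?_
  rintro _ ⟨f, rfl⟩
  rw [coe_eq_sum]
  exact Submodule.sum_mem _ fun x _ => Submodule.smul_mem _ _ (Submodule.subset_span ⟨x, rfl⟩)

theorem ext_inner_tmul {u v : HilbertTensor H} (h : ∀ x, ⟪tmul x, u⟫_ℂ = ⟪tmul x, v⟫_ℂ) :
    u = v := by
  refine UniformSpace.Completion.denseRange_coe.eq_of_inner_right ℂ fun f => ?_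
  rw [coe_eq_sum, Finsupp.sum, sum_inner, sum_inner]
  simp [inner_smul_left, h]

theorem tmul_update_add [DecidableEq ι] (x : ∀ k, H k) (i : ι) (a b : H i) :
    tmul (Function.update x i (a + b))
      = tmul (Function.update x i a) + tmul (Function.update x i b) := by
  refine ext_inner_tmul fun z => ?_
  rw [inner_add_right, inner_tmul, inner_tmul, inner_tmul]
  simp only [← Finset.prod_erase_mul _ _ (Finset.mem_univ i), Function.update_self,
    inner_add_right, mul_add]
  congr 2 <;> exact Finset.prod_congr rfl fun k hk => by
    simp only [Function.update_of_ne (Finset.ne_of_mem_erase hk)]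

theorem tmul_update_smul [DecidableEq ι] (x : ∀ k, H k) (i : ι) (r : ℂ) (a : H i) :
    tmul (Function.update x i (r • a)) = r • tmul (Function.update x i a) := by
  refine ext_inner_tmul fun z => ?_
  rw [inner_smul_right, inner_tmul, inner_tmul]
  simp only [← Finset.prod_erase_mul _ _ (Finset.mem_univ i), Function.update_self,
    inner_smul_right]
  rw [mul_left_comm]
  congr 2
  exact Finset.prod_congr rfl fun k hk => by
    simp only [Function.update_of_ne (Finset.ne_of_mem_erase hk)]

theorem inner_mapDomain_self (f : ∀ k, H k →L[ℂ] G k) (z : PreTensor H) :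
    ⟪(z.mapDomain fun x k => f k (x k) : PreTensor G), z.mapDomain fun x k => f k (x k)⟫_ℂ
      = z.sum fun x r => z.sum fun y s => star r * (∏ k, ⟪f k (x k), f k (y k)⟫_ℂ) * s := by
  rw [PreTensor.inner_def, Finsupp.sum_mapDomain_index]
  · refine Finsupp.sum_congr fun x _ => ?_
    rw [Finsupp.sum_mapDomain_index]
    · rfl
    · simp
    · intros; ring
  · simp
  · intros; simp [add_mul, ← Finsupp.sum_add]

theorem norm_mapDomain_le (f : ∀ k, H k →L[ℂ] G k) (z : PreTensor H) :
    ‖(z.mapDomain fun x k => f k (x k) : PreTensor G)‖ ≤ (∏ k, ‖f k‖) * ‖z‖ := by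
  refine (sq_le_sq₀ (norm_nonneg _) (by positivity)).1 ?_
  rw [mul_pow, ← inner_self_eq_norm_sq (𝕜 := ℂ), ← inner_self_eq_norm_sq (𝕜 := ℂ),
    inner_mapDomain_self, PreTensor.inner_def]
  have key := (posSemidef_prod_sub_prod (Finset.univ : Finset ι)
    (fun k => ‖f k‖ ^ 2 • Matrix.gram ℂ fun x : ∀ k, H k => x k)
    (fun k => Matrix.gram ℂ fun x : ∀ k, H k => f k (x k))
    (fun k => (posSemidef_gram_of_any _).smul (sq_nonneg _))
    (fun k => posSemidef_gram_of_any _)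
    (fun k => Matrix.posSemidef_opNorm_smul_gram_sub_gram _ (f k))).2 z
  have h1 := (Complex.le_def.1 key).1
  simp only [Finsupp.sum, Matrix.of_apply, Matrix.smul_apply, Matrix.gram_apply,
    Complex.real_smul, Finset.prod_mul_distrib, mul_sub, sub_mul, Finset.sum_sub_distrib,
    Complex.sub_re, Complex.zero_re, sub_nonneg] at h1
  refine h1.trans (le_of_eq ?_)
  have e : ∀ w : ℂ, (∏ k, ‖f k‖) ^ 2 * RCLike.re w
      = ((∏ k, (((‖f k‖ ^ 2 : ℝ)) : ℂ)) * w).re := by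
    intro w
    rw [← Complex.ofReal_prod, Complex.re_ofReal_mul, Finset.prod_pow]
    rfl
  rw [e]
  congr 1
  simp only [Finsupp.sum, Finset.mul_sum, tensorKernel, Matrix.of_apply]
  refine Finset.sum_congr rfl fun x _ => Finset.sum_congr rfl fun y _ => ?_
  ring

/-- The bounded operator `⨂ₖ fₖ`, see `map_tmul`. -/
noncomputable def map (f : ∀ k, H k →L[ℂ] G k) : HilbertTensor H →L[ℂ] HilbertTensor G :=
  ((Finsupp.lmapDomain ℂ ℂ fun (x : ∀ k, H k) k => f k (x k) :
    PreTensor H →ₗ[ℂ] PreTensor G).mkContinuous (∏ k, ‖f k‖) (norm_mapDomain_le f)).completion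

theorem map_tmul (f : ∀ k, H k →L[ℂ] G k) (x : ∀ k, H k) :
    map f (tmul x) = tmul fun k => f k (x k) := by
  rw [map, tmul, ContinuousLinearMap.completion_apply_coe]
  exact congrArg _ Finsupp.mapDomain_single

end HilbertTensor

end HilbertTensor

/-! ### Behaviours, connectors and connector complexes with outcomes `±1` -/

section Connectors

open MeasureTheory

open scoped InnerProductSpace

universe u

/-- The values `a|x` of a leg with `m` settings: an outcome `a = ±1` and a setting `x`. -/
abbrev Leg (m : ℕ) : Type := ℤˣ × Fin m

/-- A system of `m` two-outcome POVMs `A_{a|x}` on `E`. -/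
structure IsMeasurement {E : Type u} [NormedAddCommGroup E] [InnerProductSpace ℂ E] {m : ℕ}
    (A : Leg m → E →L[ℂ] E) : Prop where
  isPositive : ∀ e, (A e).IsPositive
  sum_eq_one : ∀ x, ∑ a, A (a, x) = 1

/-- A system of `m` two-outcome projective measurements on `E`. -/
structure IsProjectiveMeasurement {E : Type u} [NormedAddCommGroup E] [InnerProductSpace ℂ E]
    [CompleteSpace E] {m : ℕ} (A : Leg m → E →L[ℂ] E) : Prop where
  isStarProjection : ∀ e, IsStarProjection (A e)
  sum_eq_one : ∀ x, ∑ a, A (a, x) = 1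

/-- The dichotomic operator `K_x = A_{+1|x} - A_{-1|x}`. -/
def dichotomic {E : Type u} [NormedAddCommGroup E] [InnerProductSpace ℂ E] {m : ℕ}
    (A : Leg m → E →L[ℂ] E) (x : Fin m) : E →L[ℂ] E :=
  A (1, x) - A (-1, x)

variable {ι : Type} [Fintype ι]

/-- A tensor `P(a|x)` with one leg for each party `k : ι`, who has `m k` settings. -/
abbrev Behaviour (m : ι → ℕ) : Type := (∀ k, Leg (m k)) → ℝ

/-- `P(a|x) = Tr(ρ ⨂ₖ A⁽ᵏ⁾_{aₖ|xₖ})` for POVMs `A⁽ᵏ⁾` on Hilbert spaces `Hₖ` and a density operator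
`ρ = ∑ⱼ pⱼ |ψⱼ⟩⟨ψⱼ|` on `⨂ₖ Hₖ`. -/
def IsQuantum {m : ι → ℕ} (P : Behaviour m) : Prop :=
  ∃ (H : ι → Type u) (_ : ∀ k, NormedAddCommGroup (H k)) (_ : ∀ k, InnerProductSpace ℂ (H k))
    (_ : ∀ k, CompleteSpace (H k)) (A : ∀ k, Leg (m k) → H k →L[ℂ] H k)
    (p : ℕ → ℝ) (ψ : ℕ → HilbertTensor H),
    (∀ k, IsMeasurement (A k)) ∧ (∀ j, 0 ≤ p j) ∧ HasSum p 1 ∧ (∀ j, ‖ψ j‖ = 1) ∧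
    ∀ z, HasSum (fun j => (p j : ℂ) * ⟪ψ j, HilbertTensor.map (fun k => A k (z k)) (ψ j)⟫_ℂ)
      (P z : ℂ)

/-- A local hidden variable model: `P(a|x) = ∫ ∏ₖ rₖ(aₖ|xₖ, l) dμ(l)` for a probability measure `μ` and
response functions `rₖ`. -/
def IsClassical {m : ι → ℕ} (P : Behaviour m) : Prop :=
  ∃ (Λ : Type) (_ : MeasurableSpace Λ) (μ : Measure Λ) (_ : IsProbabilityMeasure μ)
    (r : ∀ k, Leg (m k) → Λ → ℝ),
    (∀ k e, Measurable (r k e)) ∧ (∀ k e l, 0 ≤ r k e l) ∧ (∀ k x l, ∑ a, r k (a, x) l = 1) ∧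
    ∀ z, P z = ∫ l, ∏ k, r k (z k) l ∂μ

/-- A tensor `C_{b|y}^{a|x}` with one outgoing leg (`n` settings) and incoming legs `k : ι`
(`m k` settings). -/
abbrev ConnTensor (m : ι → ℕ) (n : ℕ) : Type := Leg n → (∀ k, Leg (m k)) → ℝ

namespace ConnTensor

variable [DecidableEq ι] {m : ι → ℕ} {n : ℕ}

/-- The operators `C_{b|y}[A] = ∑ C_{b|y}^{a|x} ⨂ₖ A⁽ᵏ⁾_{aₖ|xₖ}`. -/
noncomputable def op (C : ConnTensor m n) {H : ι → Type u} [∀ k, NormedAddCommGroup (H k)]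
    [∀ k, InnerProductSpace ℂ (H k)] (A : ∀ k, Leg (m k) → H k →L[ℂ] H k) (e : Leg n) :
    HilbertTensor H →L[ℂ] HilbertTensor H :=
  ∑ z, (C e z : ℂ) • HilbertTensor.map fun k => A k (z k)

/-- Normalized connectors: `C[A]` is a system of POVMs whenever all `A⁽ᵏ⁾` are. -/
def IsConnector (C : ConnTensor m n) : Prop :=
  ∀ (H : ι → Type u) [∀ k, NormedAddCommGroup (H k)] [∀ k, InnerProductSpace ℂ (H k)]
    [∀ k, CompleteSpace (H k)] (A : ∀ k, Leg (m k) → H k →L[ℂ] H k),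
    (∀ k, IsMeasurement (A k)) → IsMeasurement (C.op A)

/-- Each `C_y = C_{+1|y} - C_{-1|y}` is a full-correlation functional `∑ₓ c_{y,x} ⨂ₖ K⁽ᵏ⁾_{xₖ}`. -/
def IsXOR (C : ConnTensor m n) : Prop :=
  ∃ c : Fin n → (∀ k, Fin (m k)) → ℝ,
    ∀ (H : ι → Type u) [∀ k, NormedAddCommGroup (H k)] [∀ k, InnerProductSpace ℂ (H k)]
      [∀ k, CompleteSpace (H k)] (A : ∀ k, Leg (m k) → H k →L[ℂ] H k),
      (∀ k, IsMeasurement (A k)) → ∀ y,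
        dichotomic (C.op A) y
          = ∑ x, (c y x : ℂ) • HilbertTensor.map fun k => dichotomic (A k) (x k)

/-- The value `⟨C_y⟩_P` of the functional `C_y = ∑_b b C_{b|y}` on `P`. -/
def value (C : ConnTensor m n) (y : Fin n) (P : Behaviour m) : ℝ :=
  ∑ b : ℤˣ, ((b : ℤ) : ℝ) * ∑ z, C (b, y) z * P z

/-- The numbers `g` with `-1 ≤ g ⟨C_y⟩_P ≤ 1` for all `y` and all classical behaviours `P`. -/
def classicalFactors (C : ConnTensor m n) : Set ℝ :=
  {g | ∀ y P, IsClassical P → -1 ≤ g * C.value y P ∧ g * C.value y P ≤ 1}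

/-- The quantum-to-classical ratio `γ(C)`, the largest element of `classicalFactors`. -/
noncomputable def gamma (C : ConnTensor m n) : ℝ := sSup C.classicalFactors

/-- The maximal value of `⟨C_y⟩_P` over the quantum behaviours. -/
noncomputable def quantumMax (C : ConnTensor m n) (y : Fin n) : ℝ :=
  sSup {v | ∃ P, IsQuantum.{u} P ∧ C.value y P = v}

/-- The maximal value of `⟨C_y⟩_P` over the classical behaviours. -/
noncomputable def classicalMax (C : ConnTensor m n) (y : Fin n) : ℝ :=
  sSup {v | ∃ P, IsClassical P ∧ C.value y P = v}

end ConnTensor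

/-- A connector complex `(C, Ā, V)`: a normalized `q → 1` connector `C`, measurement systems `Ā⁽ᵏ⁾` on
`Hₖ` and a coisometry `V : ⨂ₖ Hₖ → Hout` such that the `V C_{b|y}[Ā] V†` form projective measurements.
The output system is nonzero. -/
structure ConnectorComplex where
  q : ℕ
  q_pos : 0 < q
  m : Fin q → ℕ
  n : ℕ
  C : ConnTensor m n
  H : Fin q → Type u
  [normedH : ∀ k, NormedAddCommGroup (H k)]
  [innerH : ∀ k, InnerProductSpace ℂ (H k)]
  [completeH : ∀ k, CompleteSpace (H k)]
  Hout : Type u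
  [normedOut : NormedAddCommGroup Hout]
  [innerOut : InnerProductSpace ℂ Hout]
  [completeOut : CompleteSpace Hout]
  [nontrivialOut : Nontrivial Hout]
  A : ∀ k, Leg (m k) → H k →L[ℂ] H k
  V : HilbertTensor H →L[ℂ] Hout
  isConnector : ConnTensor.IsConnector.{u} C
  isMeasurement : ∀ k, IsMeasurement (A k)
  coisometry : V ∘L ContinuousLinearMap.adjoint V = ContinuousLinearMap.id ℂ Hout
  isProjective : IsProjectiveMeasurement fun e =>
    V ∘L C.op A e ∘L ContinuousLinearMap.adjoint V

attribute [instance] ConnectorComplex.normedH ConnectorComplex.innerH ConnectorComplex.completeH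
  ConnectorComplex.normedOut ConnectorComplex.innerOut ConnectorComplex.completeOut
  ConnectorComplex.nontrivialOut

/-- The renormalized measurements `M̄_{b|y} = V C_{b|y}[Ā] V†`. -/
noncomputable def ConnectorComplex.M (D : ConnectorComplex.{u}) (e : Leg D.n) :
    D.Hout →L[ℂ] D.Hout :=
  D.V ∘L D.C.op D.A e ∘L ContinuousLinearMap.adjoint D.V

/-- A connector complex whose connector is an XOR connector. -/
structure XORComplex extends ConnectorComplex.{u} where
  isXOR : ConnTensor.IsXOR.{u} C

/-- A tree-like network of XOR complexes with one root, whose outgoing leg has `n` settings. In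
`node D child` the output of the network `child k` is plugged into the `k`-th incoming leg of `D`;
`child k = wire _` means that this leg is left open. -/
inductive Network : ℕ → Type (u + 1)
  | wire (n : ℕ) : Network n
  | node (D : XORComplex.{u}) (child : ∀ k : Fin D.q, Network (D.m k)) : Network D.n

namespace Network

/-- The open incoming legs of the network, i.e. the parties of the contracted functional. -/
def Leaf : {n : ℕ} → Network.{u} n → Type
  | _, wire _ => Unit
  | _, node D child => Σ k : Fin D.q, (child k).Leaf

/-- The complexes of the network (the root, or a complex in one of the subnetworks). -/
def Node : {n : ℕ} → Network.{u} n → Type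
  | _, wire _ => Empty
  | _, node D child => Option (Σ k : Fin D.q, (child k).Node)

instance instFintypeLeaf : {n : ℕ} → (T : Network.{u} n) → Fintype T.Leaf
  | _, wire _ => inferInstanceAs (Fintype Unit)
  | _, node D child =>
    letI := fun k => instFintypeLeaf (child k)
    inferInstanceAs (Fintype (Σ k : Fin D.q, (child k).Leaf))

instance instDecidableEqLeaf : {n : ℕ} → (T : Network.{u} n) → DecidableEq T.Leaf
  | _, wire _ => inferInstanceAs (DecidableEq Unit)
  | _, node D child =>
    letI := fun k => instDecidableEqLeaf (child k)
    inferInstanceAs (DecidableEq (Σ k : Fin D.q, (child k).Leaf))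

instance instFintypeNode : {n : ℕ} → (T : Network.{u} n) → Fintype T.Node
  | _, wire _ => inferInstanceAs (Fintype Empty)
  | _, node D child =>
    letI := fun k => instFintypeNode (child k)
    inferInstanceAs (Fintype (Option (Σ k : Fin D.q, (child k).Node)))

/-- The complex at a node. -/
def complexAt : {n : ℕ} → (T : Network.{u} n) → T.Node → XORComplex.{u}
  | _, wire _ => fun v => v.elim
  | _, node D child => fun v => v.elim D fun w => (child w.1).complexAt w.2

/-- The number of settings of a party. -/
def settings : {n : ℕ} → (T : Network.{u} n) → T.Leaf → ℕ
  | _, wire n => fun _ => n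
  | _, node _ child => fun l => (child l.1).settings l.2

/-- The contraction of the tensors of the network; an open leg carries the identity. -/
def tensor : {n : ℕ} → (T : Network.{u} n) → ConnTensor T.settings n
  | _, wire n => fun e z => (1 : Matrix (Leg n) (Leg n) ℝ) e (z ())
  | _, node D child => fun e z =>
    ∑ w : ∀ k, Leg (D.m k), D.C e w * ∏ k, (child k).tensor (w k) fun l => z ⟨k, l⟩

/-- The output measurements `M̄` of the root complex coincide with `A`, up to a unitary
identification of the two Hilbert spaces. No condition if there is no root complex. -/
def OutputIs : {n : ℕ} → Network.{u} n → {E : Type u} → [NormedAddCommGroup E] →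
    [InnerProductSpace ℂ E] → (Leg n → E →L[ℂ] E) → Prop
  | _, wire _, _, _, _, _ => True
  | _, node D _, E, _, _, A => ∃ U : D.Hout ≃ₗᵢ[ℂ] E, ∀ e φ, A e (U φ) = U (D.M e φ)

/-- All contractions of the network are congruent: whenever the output of a complex `D'` is plugged
into the `k`-th incoming leg of `D`, then `M̄(D') = Ā⁽ᵏ⁾(D)`. -/
def IsCongruent : {n : ℕ} → Network.{u} n → Prop
  | _, wire _ => True
  | _, node D child => ∀ k, (child k).OutputIs (D.A k) ∧ (child k).IsCongruent

/-- `Γ`, the product of the ratios `γ` of all complexes of the network. -/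
noncomputable def bigGamma {n : ℕ} (T : Network.{u} n) : ℝ := ∏ v, (T.complexAt v).C.gamma

end Network

end Connectors

/-! ### Unitaries between Hilbert space tensor products -/

section TensorUnitary

open scoped InnerProductSpace

universe u

/-! The quantum bound holds because contraction preserves connectors
(`ConnTensor.IsConnector.comp`): up to the unitary that regroups tensor factors, the contracted
tensor feeds the POVMs produced by the subtrees into the root connector. So its operators again form
POVMs, and the difference of the two effects has expectation in `[-1, 1]`.

For attainment, the point is that a POVM whose compression to a subspace is projective leaves that
subspace invariant (`IsMeasurement.apply_adjoint_of_isProjective`). Each complex thus realizes its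
measurements `M̄` exactly on the invariant subspace `range V†`. By congruence, the measurements
entering a complex can themselves be replaced by such realizations, and tensoring the embeddings
gives a realization of the whole tree (`Realization.nonempty_comp`, `Network.nonempty_realization`).
An eigenvector of the root's dichotomic observable, with eigenvalue `1` or `-1`, becomes a joint
pure state reaching that value. The opposite value comes from flipping the outcomes of one party,
since an XOR functional is odd in each party (`ConnTensor.IsXOR.exists_isMeasurement_neg`).

For the classical bound it suffices to consider independent local responses. An XOR functional is
then a multilinear form in the mean outcomes. If the means produced by the `k`-th subtree are at
most `1/Γ_k` in modulus, multiplying them by `Γ_k` still gives legitimate means, so the bound `1/γ`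
of the root applies to the rescaled inputs. Multilinearity divides it by `∏ Γ_k`
(`Network.abs_meanOutcome_eval_le`). The maximum `γ` exists because the admissible factors form a
closed set containing `1`, bounded above by a nonzero classical value: an XOR functional that is
nonzero on operators has a nonzero coefficient, and each coefficient is itself a classical value
(`XORComplex.isGreatest_gamma`).

The exponential growth in the number of parties follows from counting leaves of a tree of bounded
branching (`Network.card_leaf_le`). -/

/-- A family with the Gram matrix of the pure tensors is the image of the pure tensors under a
linear isometry. -/
theorem HilbertTensor.exists_linearIsometry {ι : Type} [Fintype ι] {H : ι → Type u}
    [∀ k, NormedAddCommGroup (H k)] [∀ k, InnerProductSpace ℂ (H k)] {F : Type*}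
    [NormedAddCommGroup F] [InnerProductSpace ℂ F] [CompleteSpace F] (v : (∀ k, H k) → F)
    (hv : ∀ x y, ⟪v x, v y⟫_ℂ = ∏ k, ⟪x k, y k⟫_ℂ) :
    ∃ W : HilbertTensor H →ₗᵢ[ℂ] F, ∀ x, W (tmul x) = v x := by
  let f : PreTensor H →ₗ[ℂ] F := Finsupp.linearCombination ℂ v
  have hf : ∀ a b, ⟪f a, f b⟫_ℂ = ⟪a, b⟫_ℂ := by
    intro a b
    simp only [f, Finsupp.linearCombination_apply, Finsupp.sum, PreTensor.inner_def, sum_inner,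
      inner_sum, inner_smul_left, inner_smul_right, hv, tensorKernel, Matrix.of_apply,
      RCLike.star_def]
    rw [Finset.sum_comm]
    refine Finset.sum_congr rfl fun x _ => ?_
    rw [Finset.mul_sum]
    exact Finset.sum_congr rfl fun y _ => by ring
  let g : PreTensor H →ₗᵢ[ℂ] F := f.isometryOfInner hf
  let W := g.toContinuousLinearMap.extend (UniformSpace.Completion.toComplL (𝕜 := ℂ))
  have hW : ∀ a : PreTensor H, W (a : HilbertTensor H) = g a := fun a =>
    ContinuousLinearMap.extend_eq g.toContinuousLinearMap
      UniformSpace.Completion.denseRange_coe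
      (UniformSpace.Completion.isUniformInducing_coe _) a
  refine ⟨⟨W.toLinearMap, fun a => ?_⟩, fun x => ?_⟩
  · induction a using UniformSpace.Completion.induction_on with
    | hp => exact isClosed_eq (by fun_prop) (by fun_prop)
    | ih a =>
      change ‖W a‖ = _
      rw [hW, g.norm_map, UniformSpace.Completion.norm_coe]
  · change W _ = _
    rw [tmul, hW]
    simp [g, f]

theorem LinearIsometry.surjective_of_dense {E F : Type*} [NormedAddCommGroup E]
    [InnerProductSpace ℂ E] [CompleteSpace E] [NormedAddCommGroup F] [InnerProductSpace ℂ F]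
    (W : E →ₗᵢ[ℂ] F) {s : Set F} (hs : Dense (Submodule.span ℂ s : Set F))
    (h : ∀ v ∈ s, v ∈ Set.range W) : Function.Surjective W := by
  have hc : IsClosed (Set.range W) := W.isometry.isClosedEmbedding.isClosed_range
  have hr : (Submodule.span ℂ s : Set F) ⊆ Set.range W := by
    have : Submodule.span ℂ s ≤ LinearMap.range W.toLinearMap := Submodule.span_le.2 h
    exact this
  intro v
  have := hs.closure_eq ▸ closure_minimal hr hc
  exact this (Set.mem_univ v)

namespace HilbertTensor

variable {ι : Type} [Fintype ι] {H G : ι → Type u}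
  [∀ k, NormedAddCommGroup (H k)] [∀ k, InnerProductSpace ℂ (H k)]
  [∀ k, NormedAddCommGroup (G k)] [∀ k, InnerProductSpace ℂ (G k)]

theorem clm_ext {F : Type*} [NormedAddCommGroup F] [NormedSpace ℂ F]
    {S T : HilbertTensor H →L[ℂ] F} (h : ∀ x, S (tmul x) = T (tmul x)) : S = T :=
  ContinuousLinearMap.ext_on dense_span_tmul (by rintro _ ⟨x, rfl⟩; exact h x)

theorem map_sum_smul [DecidableEq ι] {κ : ι → Type*} [∀ k, Fintype (κ k)] (a : ∀ k, κ k → ℂ)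
    (f : ∀ k, κ k → H k →L[ℂ] G k) :
    map (fun k => ∑ j, a k j • f k j)
      = ∑ z : ∀ k, κ k, (∏ k, a k (z k)) • map fun k => f k (z k) := by
  refine clm_ext fun x => ext_inner_tmul fun y => ?_
  simp only [map_tmul, inner_tmul, sum_apply, smul_apply,
    inner_sum, inner_smul_right, Finset.prod_univ_sum, Fintype.piFinset_univ,
    Finset.prod_mul_distrib]

theorem map_smul_univ (a : ι → ℂ) (f : ∀ k, H k →L[ℂ] G k) :
    map (fun k => a k • f k) = (∏ k, a k) • map f := by
  refine clm_ext fun x => ext_inner_tmul fun y => ?_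
  simp only [map_tmul, inner_tmul, smul_apply, inner_smul_right,
    Finset.prod_mul_distrib]

/-- The tensor product of isometries. -/
theorem exists_mapIsometry (J : ∀ k, H k →ₗᵢ[ℂ] G k) :
    ∃ W : HilbertTensor H →ₗᵢ[ℂ] HilbertTensor G,
      W.toContinuousLinearMap = map fun k => (J k).toContinuousLinearMap := by
  obtain ⟨W, hW⟩ := exists_linearIsometry (H := H) (fun x => tmul fun k => J k (x k)) (by
    intro x y; simp [inner_tmul])
  exact ⟨W, clm_ext fun x => by simp [hW, map_tmul]⟩

/-- A tensor product with a single factor. -/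
theorem exists_unitEquiv (E : Unit → Type u) [∀ k, NormedAddCommGroup (E k)]
    [∀ k, InnerProductSpace ℂ (E k)] [∀ k, CompleteSpace (E k)] :
    ∃ S : E () ≃ₗᵢ[ℂ] HilbertTensor E, ∀ x, S x = tmul fun _ => x := by
  obtain ⟨W, hW⟩ := exists_linearIsometry (H := E) (fun x => x ()) (by
    intro x y; simp)
  have hs : Function.Surjective W := fun x => ⟨tmul fun _ => x, hW _⟩
  refine ⟨(LinearIsometryEquiv.ofSurjective W hs).symm, fun x => ?_⟩
  rw [LinearIsometryEquiv.symm_apply_eq]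
  exact (hW fun _ => x).symm

section Sigma

variable {κ : ι → Type} [∀ k, Fintype (κ k)] (L : (Σ k, κ k) → Type u)
  [∀ l, NormedAddCommGroup (L l)] [∀ l, InnerProductSpace ℂ (L l)]

theorem continuous_tmul_update [DecidableEq ι] (x : ∀ k, H k) (i : ι) :
    Continuous fun a : H i => tmul (Function.update x i a) := by
  let f : H i →ₗ[ℂ] HilbertTensor H :=
    { toFun := fun a => tmul (Function.update x i a)
      map_add' := tmul_update_add x i
      map_smul' := tmul_update_smul x i }
  refine AddMonoidHomClass.continuous_of_bound f (∏ k ∈ Finset.univ.erase i, ‖x k‖) fun a => ?_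
  have e : ∀ z : ∀ k, H k, ‖(tmul z : HilbertTensor H)‖ = ∏ k, ‖z k‖ := by
    intro z
    refine (sq_eq_sq₀ (norm_nonneg _) (Finset.prod_nonneg fun _ _ => norm_nonneg _)).1 ?_
    have : ((‖tmul z‖ ^ 2 : ℝ) : ℂ) = (((∏ k, ‖z k‖) ^ 2 : ℝ) : ℂ) := by
      rw [← Finset.prod_pow]
      push_cast
      have := inner_tmul z z
      simpa [inner_self_eq_norm_sq_to_K] using this
    exact_mod_cast this
  change ‖tmul (Function.update x i a)‖ ≤ _
  rw [e, ← Finset.prod_erase_mul _ _ (Finset.mem_univ i), Function.update_self]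
  refine le_of_eq ?_
  congr 1
  exact Finset.prod_congr rfl fun k hk => by
    rw [Function.update_of_ne (Finset.ne_of_mem_erase hk)]

/-- Pure tensors with factors from sets with dense span lie in every closed subspace containing
the pure tensors built from these sets. -/
theorem tmul_mem_of_dense [DecidableEq ι] (s : ∀ k, Set (H k))
    (hs : ∀ k, Dense (Submodule.span ℂ (s k) : Set (H k)))
    (R : Submodule ℂ (HilbertTensor H)) (hR : IsClosed (R : Set (HilbertTensor H)))
    (h : ∀ x : ∀ k, H k, (∀ k, x k ∈ s k) → tmul x ∈ R) (x : ∀ k, H k) : tmul x ∈ R := by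
  -- The factors are freed one at a time: `t` is the set of positions whose factor is already
  -- arbitrary.
  suffices ∀ t : Finset ι, ∀ x : ∀ k, H k, (∀ k ∉ t, x k ∈ s k) → tmul x ∈ R from
    this Finset.univ x fun k hk => absurd (Finset.mem_univ k) hk
  intro t
  induction t using Finset.induction_on with
  | empty => exact fun x hx => h x fun k => hx k (Finset.notMem_empty k)
  | insert i t _ ih =>
    intro x hx
    let f : H i →ₗ[ℂ] HilbertTensor H :=
      { toFun := fun a => tmul (Function.update x i a)
        map_add' := tmul_update_add x i
        map_smul' := tmul_update_smul x i }
    have hf : Continuous f := continuous_tmul_update x i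
    have h1 : Submodule.span ℂ (s i) ≤ R.comap f := by
      refine Submodule.span_le.2 fun a ha => ih _ fun k hk => ?_
      by_cases hki : k = i
      · subst hki
        simpa using ha
      · rw [Function.update_of_ne hki]
        exact hx k (by simp [hki, hk])
    have h2 : closure (Submodule.span ℂ (s i) : Set (H i)) ⊆ f ⁻¹' R :=
      closure_minimal h1 (hR.preimage hf)
    have h3 := h2 ((hs i).closure_eq ▸ Set.mem_univ (x i))
    simpa [f] using h3

/-- Associativity of the Hilbert space tensor product. -/
theorem exists_sigmaEquiv :
    ∃ W : HilbertTensor L ≃ₗᵢ[ℂ] HilbertTensor (fun k => HilbertTensor fun l : κ k => L ⟨k, l⟩),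
      ∀ x, W (tmul x) = tmul fun k => tmul fun l => x ⟨k, l⟩ := by
  classical
  obtain ⟨W, hW⟩ := exists_linearIsometry (H := L)
    (F := HilbertTensor (fun k => HilbertTensor fun l : κ k => L ⟨k, l⟩))
    (fun x => tmul fun k => tmul fun l => x ⟨k, l⟩) (by
    intro x y
    simp only [inner_tmul, Fintype.prod_sigma])
  refine ⟨LinearIsometryEquiv.ofSurjective W ?_, hW⟩
  refine W.surjective_of_dense dense_span_tmul ?_
  rintro _ ⟨x, rfl⟩
  -- An isometry on a complete space has closed range, so only pure tensors of pure tensors have to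
  -- be hit.
  refine tmul_mem_of_dense (fun k => Set.range tmul) (fun k => dense_span_tmul)
    (LinearMap.range W.toLinearMap) W.isometry.isClosedEmbedding.isClosed_range ?_ x
  intro x hx
  choose z hz using hx
  refine ⟨tmul fun l : Σ k, κ k => z l.1 l.2, ?_⟩
  change W _ = _
  rw [hW]
  exact congrArg _ (funext hz)

end Sigma

end HilbertTensor

end TensorUnitary

/-! ### Classical responses as scalar measurements -/

section Responses

open MeasureTheory

open scoped InnerProductSpace

universe u

variable {ι : Type} [Fintype ι] {m : ι → ℕ} {n : ℕ}

theorem sum_intUnits {M : Type*} [AddCommMonoid M] (f : ℤˣ → M) : ∑ a, f a = f 1 + f (-1) := by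
  have h : (Finset.univ : Finset ℤˣ) = {1, -1} := rfl
  rw [h, Finset.sum_pair (by decide)]

/-- A local response function: a conditional distribution of the outcome given the setting. -/
structure IsResponse {m : ℕ} (r : Leg m → ℝ) : Prop where
  nonneg : ∀ e, 0 ≤ r e
  sum_eq_one : ∀ x, ∑ a, r (a, x) = 1

/-- The mean outcome of a response function. -/
def meanOutcome {m : ℕ} (r : Leg m → ℝ) (x : Fin m) : ℝ := r (1, x) - r (-1, x)

theorem IsResponse.abs_meanOutcome_le {m : ℕ} {r : Leg m → ℝ} (h : IsResponse r) (x : Fin m) :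
    |meanOutcome r x| ≤ 1 := by
  have h1 := h.nonneg (1, x)
  have h2 := h.nonneg (-1, x)
  have h3 := h.sum_eq_one x
  rw [sum_intUnits] at h3
  rw [meanOutcome, abs_le]
  constructor <;> linarith

/-- Every function with values in `[-1, 1]` is the mean outcome of a response function. -/
theorem exists_isResponse_meanOutcome {m : ℕ} (K : Fin m → ℝ) (hK : ∀ x, |K x| ≤ 1) :
    ∃ r, IsResponse r ∧ meanOutcome r = K := by
  -- The only distribution on `±1` with mean `K x`.
  refine ⟨fun e => (1 + ((e.1 : ℤ) : ℝ) * K e.2) / 2, ⟨?_, ?_⟩, ?_⟩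
  · rintro ⟨a, x⟩
    have := abs_le.1 (hK x)
    rcases Int.units_eq_one_or a with rfl | rfl
    · simp; linarith
    · simp; linarith
  · intro x
    rw [sum_intUnits]
    simp
    ring
  · funext x
    simp [meanOutcome]
    ring

theorem isClassical_prod {r : ∀ k, Leg (m k) → ℝ} (h : ∀ k, IsResponse (r k)) :
    IsClassical (fun z => ∏ k, r k (z k)) :=
  ⟨Unit, ⊤, Measure.dirac (), inferInstance, fun k e _ => r k e, fun _ _ => measurable_const,
    fun k e _ => (h k).nonneg e, fun k x _ => (h k).sum_eq_one x, fun z => by simp⟩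

/-- A one-dimensional Hilbert space in any universe. -/
abbrev ScalarSpace : Type u := EuclideanSpace ℂ PUnit.{u + 1}

theorem HilbertTensor.map_one {H : ι → Type u} [∀ k, NormedAddCommGroup (H k)]
    [∀ k, InnerProductSpace ℂ (H k)] : map (fun k => (1 : H k →L[ℂ] H k)) = 1 :=
  clm_ext fun x => by simp [map_tmul]

theorem IsResponse.isMeasurement {m : ℕ} {r : Leg m → ℝ} (h : IsResponse r) {E : Type u}
    [NormedAddCommGroup E] [InnerProductSpace ℂ E] :
    IsMeasurement fun e => (r e : ℂ) • (1 : E →L[ℂ] E) where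
  isPositive e := by
    have h1 : (1 : E →L[ℂ] E).IsPositive := ContinuousLinearMap.isPositive_one
    exact h1.smul_of_nonneg (by exact_mod_cast h.nonneg e)
  sum_eq_one x := by
    rw [← Finset.sum_smul, ← Complex.ofReal_sum, h.sum_eq_one]
    simp

theorem isResponse_of_isMeasurement {m : ℕ} {r : Leg m → ℝ} {E : Type u}
    [NormedAddCommGroup E] [InnerProductSpace ℂ E] {v : E} (hv : ‖v‖ = 1)
    (h : IsMeasurement fun e => (r e : ℂ) • (1 : E →L[ℂ] E)) : IsResponse r where
  nonneg e := by
    have := (h.isPositive e).2 v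
    rw [ContinuousLinearMap.reApplyInnerSelf_apply, smul_apply, inner_smul_left] at this
    simpa [hv, inner_self_eq_norm_sq_to_K] using this
  sum_eq_one x := by
    have := h.sum_eq_one x
    rw [← Finset.sum_smul, ← Complex.ofReal_sum] at this
    have := congrArg (fun T : E →L[ℂ] E => ⟪v, T v⟫_ℂ) this
    simp only [smul_apply, inner_smul_right, one_apply_eq_self,
      inner_self_eq_norm_sq_to_K, hv, map_one, one_pow, mul_one] at this
    simpa using Complex.ofReal_injective (this.trans (by simp))

/-- A unit vector of the tensor product of one-dimensional spaces. -/
theorem exists_norm_eq_one_scalarSpace :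
    ∃ v : HilbertTensor (fun _ : ι => ScalarSpace.{u}), ‖v‖ = 1 := by
  refine ⟨HilbertTensor.tmul fun _ => EuclideanSpace.single PUnit.unit 1, ?_⟩
  rw [← sq_eq_sq₀ (norm_nonneg _) zero_le_one, ← inner_self_eq_norm_sq (𝕜 := ℂ),
    HilbertTensor.inner_tmul]
  simp

variable [DecidableEq ι]

namespace ConnTensor

/-- The conditional distribution of the output for independent local responses. -/
def eval (C : ConnTensor m n) (r : ∀ k, Leg (m k) → ℝ) (e : Leg n) : ℝ :=
  ∑ z, C e z * ∏ k, r k (z k)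

theorem value_prod (C : ConnTensor m n) (r : ∀ k, Leg (m k) → ℝ) (y : Fin n) :
    C.value y (fun z => ∏ k, r k (z k)) = meanOutcome (C.eval r) y := by
  simp only [value, meanOutcome, eval]
  rw [sum_intUnits]
  simp
  ring

end ConnTensor

/-- The functional is linear in the behaviour, and a hidden variable model is an average of product
behaviours; so a bound for independent responses survives integration. -/
theorem ConnTensor.abs_value_le_of_isClassical (C : ConnTensor m n) (y : Fin n) {B : ℝ}
    (hB : ∀ r : ∀ k, Leg (m k) → ℝ, (∀ k, IsResponse (r k)) → |meanOutcome (C.eval r) y| ≤ B)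
    {P : Behaviour m} (hP : IsClassical P) : |C.value y P| ≤ B := by
  obtain ⟨Λ, _, μ, _, r, hmeas, hnn, hsum, hP⟩ := hP
  have hr : ∀ l k, IsResponse fun e => r k e l := fun l k =>
    ⟨fun e => hnn k e l, fun x => hsum k x l⟩
  have hle : ∀ k e l, r k e l ≤ 1 := by
    rintro k ⟨a, x⟩ l
    rw [← hsum k x l]
    exact Finset.single_le_sum (f := fun a => r k (a, x) l) (fun a _ => hnn k (a, x) l)
      (Finset.mem_univ a)
  have hint : ∀ z : ∀ k, Leg (m k), Integrable (fun l => ∏ k, r k (z k) l) μ := by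
    intro z
    refine Integrable.of_bound (C := 1)
      (Finset.measurable_prod _ fun k _ => hmeas k (z k)).aestronglyMeasurable
      (Filter.Eventually.of_forall fun l => ?_)
    rw [Real.norm_of_nonneg (Finset.prod_nonneg fun k _ => hnn k _ l)]
    exact Finset.prod_le_one (fun k _ => hnn k _ l) fun k _ => hle k _ l
  have e : C.value y P = ∫ l, C.value y (fun z => ∏ k, r k (z k) l) ∂μ := by
    simp only [value, hP]
    rw [integral_finsetSum _ fun b _ => (integrable_finsetSum _ fun z _ =>
      (hint z).const_mul _).const_mul _]
    refine Finset.sum_congr rfl fun b _ => ?_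
    rw [integral_const_mul, integral_finsetSum _ fun z _ => (hint z).const_mul _]
    simp only [integral_const_mul]
  rw [e]
  have := norm_integral_le_of_norm_le_const (μ := μ) (C := B)
    (f := fun l => C.value y (fun z => ∏ k, r k (z k) l)) (Filter.Eventually.of_forall fun l => by
      rw [Real.norm_eq_abs, value_prod C (fun k e => r k e l)]
      exact hB _ (hr l))
  simpa using this

/-- Responses are POVMs consisting of multiples of the identity. This is the bridge by which the
operator conditions on connectors specialize to classical statements. -/
theorem ConnTensor.op_smul_one (C : ConnTensor m n) {H : ι → Type u}
    [∀ k, NormedAddCommGroup (H k)] [∀ k, InnerProductSpace ℂ (H k)] (r : ∀ k, Leg (m k) → ℝ)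
    (e : Leg n) :
    C.op (fun k e => (r k e : ℂ) • (1 : H k →L[ℂ] H k)) e = (C.eval r e : ℂ) • 1 := by
  simp only [op, eval, HilbertTensor.map_smul_univ, HilbertTensor.map_one, smul_smul,
    ← Finset.sum_smul]
  push_cast
  rfl

theorem ConnTensor.IsConnector.eval {C : ConnTensor m n} (hC : IsConnector.{u} C)
    {r : ∀ k, Leg (m k) → ℝ} (h : ∀ k, IsResponse (r k)) : IsResponse (C.eval r) := by
  obtain ⟨v, hv⟩ := exists_norm_eq_one_scalarSpace.{u} (ι := ι)
  have := hC (fun _ => ScalarSpace.{u}) _ fun k => (h k).isMeasurement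
  refine isResponse_of_isMeasurement hv ?_
  simpa only [← op_smul_one] using this

/-- `c` is a family of coefficients witnessing that `C` is an XOR connector. -/
def ConnTensor.HasXORCoeffs (C : ConnTensor m n) (c : Fin n → (∀ k, Fin (m k)) → ℝ) : Prop :=
  ∀ (H : ι → Type u) [∀ k, NormedAddCommGroup (H k)] [∀ k, InnerProductSpace ℂ (H k)]
      [∀ k, CompleteSpace (H k)] (A : ∀ k, Leg (m k) → H k →L[ℂ] H k),
      (∀ k, IsMeasurement (A k)) → ∀ y,
        dichotomic (C.op A) y
          = ∑ x, (c y x : ℂ) • HilbertTensor.map fun k => dichotomic (A k) (x k)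

/-- The XOR identity for scalar measurements. It makes the classical output a multilinear form in
the mean outcomes, which is what permits rescaling inputs in the classical bound. -/
theorem ConnTensor.HasXORCoeffs.meanOutcome_eval {C : ConnTensor m n}
    {c : Fin n → (∀ k, Fin (m k)) → ℝ} (hc : HasXORCoeffs.{u} C c)
    {r : ∀ k, Leg (m k) → ℝ} (h : ∀ k, IsResponse (r k)) (y : Fin n) :
    meanOutcome (C.eval r) y = ∑ x, c y x * ∏ k, meanOutcome (r k) (x k) := by
  obtain ⟨v, hv⟩ := exists_norm_eq_one_scalarSpace.{u} (ι := ι)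
  have := hc (fun _ => ScalarSpace.{u}) _ (fun k => (h k).isMeasurement) y
  simp only [dichotomic, op_smul_one, ← sub_smul, HilbertTensor.map_smul_univ,
    HilbertTensor.map_one, smul_smul, ← Finset.sum_smul] at this
  have := congrArg (fun T => ⟪v, T v⟫_ℂ) this
  simp [inner_smul_right, hv, inner_self_eq_norm_sq_to_K] at this
  simp only [meanOutcome]
  exact_mod_cast this

end Responses

/-! ### Contraction of connectors -/

section Contraction

open scoped InnerProductSpace

universe u

variable {ι : Type} [Fintype ι] {κ : ι → Type} [∀ k, Fintype (κ k)]

namespace HilbertTensor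

variable (L : (Σ k, κ k) → Type u) [∀ l, NormedAddCommGroup (L l)]
  [∀ l, InnerProductSpace ℂ (L l)]

/-- The unitary `⨂_{(k, l)} L_{k,l} ≃ ⨂ₖ ⨂ₗ L_{k,l}`. -/
noncomputable def sigmaEquiv :
    HilbertTensor L ≃ₗᵢ[ℂ] HilbertTensor (fun k => HilbertTensor fun l : κ k => L ⟨k, l⟩) :=
  (exists_sigmaEquiv L).choose

variable {L}

theorem sigmaEquiv_tmul (x : ∀ l, L l) :
    sigmaEquiv L (tmul x) = tmul fun k => tmul fun l => x ⟨k, l⟩ :=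
  (exists_sigmaEquiv L).choose_spec x

theorem sigmaEquiv_map (f : ∀ l, L l →L[ℂ] L l) (u : HilbertTensor L) :
    sigmaEquiv L (map f u) = map (fun k => map fun l => f ⟨k, l⟩) (sigmaEquiv L u) := by
  have : (sigmaEquiv L).toContinuousLinearEquiv.toContinuousLinearMap ∘L map f
      = map (fun k => map fun l => f ⟨k, l⟩) ∘L
        (sigmaEquiv L).toContinuousLinearEquiv.toContinuousLinearMap :=
    clm_ext fun x => by simp [map_tmul, sigmaEquiv_tmul]
  exact congrArg (fun T => T u) this

/-- Expand the product of sums by multilinearity and curry the summation index. The index types `σ`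
and `β` are left general so that the identity serves both for tensors (indices in `Leg`) and for XOR
coefficients (indices are settings). -/
theorem sigmaEquiv_sum_smul_map [DecidableEq ι] [∀ k, DecidableEq (κ k)]
    {σ : (Σ k, κ k) → Type} [∀ l, Fintype (σ l)] {β : ι → Type} [∀ k, Fintype (β k)]
    (f : ∀ l, σ l → L l →L[ℂ] L l) (g : (∀ k, β k) → ℂ)
    (h : ∀ k, β k → (∀ l : κ k, σ ⟨k, l⟩) → ℂ) (u : HilbertTensor L) :
    sigmaEquiv L ((∑ z : ∀ l, σ l, (∑ w, g w * ∏ k, h k (w k) fun l => z ⟨k, l⟩) •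
        map fun l => f l (z l)) u)
      = (∑ w, g w • map fun k => ∑ z : ∀ l : κ k, σ ⟨k, l⟩,
          h k (w k) z • map fun l => f ⟨k, l⟩ (z l)) (sigmaEquiv L u) := by
  simp only [sum_apply, smul_apply, map_sum, map_smul, sigmaEquiv_map, map_sum_smul,
    Finset.sum_smul, Finset.smul_sum, smul_smul]
  rw [Finset.sum_comm]
  refine Finset.sum_congr rfl fun w _ => ?_
  exact Fintype.sum_equiv (Equiv.piCurry fun k l => σ ⟨k, l⟩) _ _ fun z => rfl

theorem inner_map_left {H : ι → Type u} [∀ k, NormedAddCommGroup (H k)]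
    [∀ k, InnerProductSpace ℂ (H k)] {f : ∀ k, H k →L[ℂ] H k}
    (hf : ∀ k, (f k).toLinearMap.IsSymmetric) (u v : HilbertTensor H) :
    ⟪map f u, v⟫_ℂ = ⟪u, map f v⟫_ℂ := by
  have : ContinuousLinearMap.adjoint (map f) = map f := by
    refine clm_ext fun x => ext_inner_tmul fun y => ?_
    rw [ContinuousLinearMap.adjoint_inner_right, map_tmul, map_tmul, inner_tmul, inner_tmul]
    exact Finset.prod_congr rfl fun k _ => hf k _ _
  rw [← ContinuousLinearMap.adjoint_inner_right, this]

end HilbertTensor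

theorem IsMeasurement.of_unitary {m : ℕ} {E F : Type u} [NormedAddCommGroup E]
    [InnerProductSpace ℂ E] [NormedAddCommGroup F] [InnerProductSpace ℂ F]
    {A : Leg m → E →L[ℂ] E} {B : Leg m → F →L[ℂ] F} (hB : IsMeasurement B) (W : E ≃ₗᵢ[ℂ] F)
    (h : ∀ e u, W (A e u) = B e (W u)) : IsMeasurement A where
  isPositive e := by
    refine ⟨fun u v => ?_, fun u => ?_⟩
    · have := (hB.isPositive e).1 (W u) (W v)
      simpa [← h] using this
    · have := (hB.isPositive e).2 (W u)
      simpa [ContinuousLinearMap.reApplyInnerSelf_apply, ← h] using this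
  sum_eq_one x := by
    ext u
    apply W.injective
    have := congrArg (fun T => T (W u)) (hB.sum_eq_one x)
    simpa only [sum_apply, map_sum, h, one_apply_eq_self] using this

variable [DecidableEq ι] [∀ k, DecidableEq (κ k)] {m : ι → ℕ} {n : ℕ}
  {s : ∀ k, κ k → ℕ}

namespace ConnTensor

/-- The contraction of the incoming legs of `C` with the outgoing legs of the `B k`. -/
def comp (C : ConnTensor m n) (B : ∀ k, ConnTensor (s k) (m k)) :
    ConnTensor (fun l : Σ k, κ k => s l.1 l.2) n :=
  fun e z => ∑ w, C e w * ∏ k, B k (w k) fun l => z ⟨k, l⟩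

variable {C : ConnTensor m n} {B : ∀ k, ConnTensor (s k) (m k)}

theorem eval_comp (r : ∀ l : Σ k, κ k, Leg (s l.1 l.2) → ℝ) :
    (C.comp B).eval r = C.eval fun k => (B k).eval fun l => r ⟨k, l⟩ := by
  funext e
  simp only [eval, comp, Finset.prod_univ_sum, Fintype.piFinset_univ, Finset.mul_sum,
    Finset.sum_mul]
  rw [Finset.sum_comm]
  refine Finset.sum_congr rfl fun w _ => ?_
  refine Fintype.sum_equiv (Equiv.piCurry fun k l => Leg (s k l)) _ _ fun z => ?_
  rw [Fintype.prod_sigma, Finset.prod_mul_distrib, mul_assoc]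
  rfl

section Operators

variable {L : (Σ k, κ k) → Type u} [∀ l, NormedAddCommGroup (L l)]
  [∀ l, InnerProductSpace ℂ (L l)]

theorem sigmaEquiv_op_comp (A : ∀ l : Σ k, κ k, Leg (s l.1 l.2) → L l →L[ℂ] L l) (e : Leg n)
    (u : HilbertTensor L) :
    HilbertTensor.sigmaEquiv L ((C.comp B).op A e u)
      = C.op (fun k => (B k).op fun l => A ⟨k, l⟩) e (HilbertTensor.sigmaEquiv L u) := by
  have := HilbertTensor.sigmaEquiv_sum_smul_map A (fun w => (C e w : ℂ))
    (fun k w z => (B k w z : ℂ)) u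
  simp only [op, comp]
  simp only [Complex.ofReal_sum, Complex.ofReal_mul, Complex.ofReal_prod]
  exact this

end Operators

theorem IsConnector.comp (hC : IsConnector.{u} C) (hB : ∀ k, IsConnector.{u} (B k)) :
    IsConnector.{u} (C.comp B) := by
  intro H _ _ _ A hA
  exact (hC _ _ fun k => hB k _ _ fun l => hA ⟨k, l⟩).of_unitary (HilbertTensor.sigmaEquiv H)
    (sigmaEquiv_op_comp A)

/-- Substituting one multilinear expression into another. The `B k` must be connectors because the
XOR identity of `C` is available only for POVM inputs. -/
theorem HasXORCoeffs.comp {c : Fin n → (∀ k, Fin (m k)) → ℝ}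
    {b : ∀ k, Fin (m k) → (∀ l, Fin (s k l)) → ℝ} (hC : HasXORCoeffs.{u} C c)
    (hB : ∀ k, HasXORCoeffs.{u} (B k) (b k)) (hB' : ∀ k, IsConnector.{u} (B k)) :
    HasXORCoeffs.{u} (C.comp B) fun y x => ∑ w, c y w * ∏ k, b k (w k) fun l => x ⟨k, l⟩ := by
  intro H _ _ _ A hA y
  ext u
  apply (HilbertTensor.sigmaEquiv H).injective
  have h1 := HilbertTensor.sigmaEquiv_sum_smul_map (fun l => dichotomic (A l))
    (fun w => (c y w : ℂ)) (fun k w z => (b k w z : ℂ)) u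
  have h2 := hC _ (fun k => (B k).op fun l => A ⟨k, l⟩) (fun k => hB' k _ _ fun l => hA ⟨k, l⟩) y
  simp only [Complex.ofReal_sum, Complex.ofReal_mul, Complex.ofReal_prod]
  refine Eq.trans ?_ h1.symm
  rw [dichotomic, sub_apply, map_sub, sigmaEquiv_op_comp, sigmaEquiv_op_comp, ← sub_apply,
    ← dichotomic, h2]
  congr 1
  refine Finset.sum_congr rfl fun w _ => ?_
  congr 2
  funext k
  exact hB k _ _ (fun l => hA ⟨k, l⟩) (w k)

end ConnTensor

end Contraction

/-! ### Invariant subspaces and realizations -/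

section Realizations

open scoped InnerProductSpace

universe u

theorem ContinuousLinearMap.IsPositive.apply_eq_zero {E : Type*} [NormedAddCommGroup E]
    [InnerProductSpace ℂ E] [CompleteSpace E] {T : E →L[ℂ] E} (hT : T.IsPositive) {x : E}
    (h : ⟪x, T x⟫_ℂ = 0) : T x = 0 := by
  -- With `T = S†S`, the hypothesis says that `‖S x‖² = 0`.
  obtain ⟨S, rfl⟩ := CStarAlgebra.nonneg_iff_eq_star_mul_self.1 (nonneg_iff_isPositive T |>.2 hT)
  rw [mul_apply_eq_comp, star_eq_adjoint, adjoint_inner_right, inner_self_eq_zero] at h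
  rw [mul_apply_eq_comp, h, map_zero]

/-- The compression of a POVM to a subspace is projective only if the subspace is invariant. -/
theorem IsMeasurement.apply_adjoint_of_isProjective {m : ℕ} {E F : Type u}
    [NormedAddCommGroup E] [InnerProductSpace ℂ E] [CompleteSpace E] [NormedAddCommGroup F]
    [InnerProductSpace ℂ F] [CompleteSpace F] {T : Leg m → E →L[ℂ] E} (hT : IsMeasurement T)
    (V : E →L[ℂ] F)
    (hP : IsProjectiveMeasurement fun e => V ∘L T e ∘L ContinuousLinearMap.adjoint V)
    (e : Leg m) (φ : F) :
    T e (ContinuousLinearMap.adjoint V φ)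
      = ContinuousLinearMap.adjoint V (V (T e (ContinuousLinearMap.adjoint V φ))) := by
  set S := ContinuousLinearMap.adjoint V with hS
  have hzero : ∀ e χ, V (T e (S χ)) = 0 → T e (S χ) = 0 := by
    intro e χ h
    refine (hT.isPositive e).apply_eq_zero ?_
    rw [hS, ContinuousLinearMap.adjoint_inner_left, ← hS, h, inner_zero_right]
  have hidem : ∀ e χ, V (T e (S (V (T e (S χ))))) = V (T e (S χ)) := fun e χ =>
    congrArg (fun R => R χ) (hP.isStarProjection e).isIdempotentElem
  obtain ⟨a, x⟩ := e
  have hM : ∀ χ, V (T (a, x) (S χ)) + V (T (-a, x) (S χ)) = χ := by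
    intro χ
    have := congrArg (fun R => R χ) (hP.sum_eq_one x)
    rw [sum_intUnits] at this
    rcases Int.units_eq_one_or a with rfl | rfl
    · exact this
    · rw [add_comm]; simpa using this
  have hE : ∀ v, T (a, x) v + T (-a, x) v = v := by
    intro v
    have := congrArg (fun R => R v) (hT.sum_eq_one x)
    rw [sum_intUnits] at this
    rcases Int.units_eq_one_or a with rfl | rfl
    · exact this
    · rw [add_comm]; simpa using this
  -- Opposite outcomes of the compressed measurement are orthogonal projectors; positivity (`hzero`)
  -- lifts the vanishing of the compression to the vector itself.
  have h1 : T (-a, x) (S (V (T (a, x) (S φ)))) = 0 := by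
    refine hzero _ _ ?_
    have := hM (V (T (a, x) (S φ)))
    rwa [hidem, add_eq_left] at this
  have h2 : T (a, x) (S (V (T (-a, x) (S φ)))) = 0 := by
    refine hzero _ _ ?_
    have := hM (V (T (-a, x) (S φ)))
    rwa [hidem, add_eq_right] at this
  -- Splitting `φ` into its two outcome components, `T_a` kills the `-a` component and, by `h1` and
  -- completeness, fixes the `a` component.
  conv_lhs => rw [← hM φ, map_add, map_add, h2, add_zero]
  have := hE (S (V (T (a, x) (S φ))))
  rwa [h1, add_zero] at this

variable {ι : Type} [Fintype ι] [DecidableEq ι] {m : ι → ℕ} {n : ℕ}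

/-- Measurements of the parties and an isometry `J` that embeds `E` as an invariant subspace, on
which `C` acts as the given operators `B`. -/
structure Realization (C : ConnTensor m n) {E : Type u} [NormedAddCommGroup E]
    [InnerProductSpace ℂ E] (B : Leg n → E →L[ℂ] E) where
  H : ι → Type u
  [normedH : ∀ k, NormedAddCommGroup (H k)]
  [innerH : ∀ k, InnerProductSpace ℂ (H k)]
  [completeH : ∀ k, CompleteSpace (H k)]
  A : ∀ k, Leg (m k) → H k →L[ℂ] H k
  J : E →ₗᵢ[ℂ] HilbertTensor H
  isMeasurement : ∀ k, IsMeasurement (A k)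
  op_apply : ∀ e φ, C.op A e (J φ) = J (B e φ)

attribute [instance] Realization.normedH Realization.innerH Realization.completeH

namespace Realization

/-- Transport along a unitary. -/
noncomputable def ofUnitary {C : ConnTensor m n} {E F : Type u} [NormedAddCommGroup E]
    [InnerProductSpace ℂ E] [NormedAddCommGroup F] [InnerProductSpace ℂ F]
    {B : Leg n → E →L[ℂ] E} (R : Realization C B) {B' : Leg n → F →L[ℂ] F} (U : E ≃ₗᵢ[ℂ] F)
    (h : ∀ e φ, B' e (U φ) = U (B e φ)) : Realization C B' where
  H := R.H
  A := R.A
  J := R.J.comp U.symm.toLinearIsometry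
  isMeasurement := R.isMeasurement
  op_apply e φ := by
    obtain ⟨φ, rfl⟩ := U.surjective φ
    simp [h, R.op_apply]

variable {κ : ι → Type} [∀ k, Fintype (κ k)] [∀ k, DecidableEq (κ k)] {s : ∀ k, κ k → ℕ}

/-- Contraction of realizations. -/
theorem nonempty_comp {C : ConnTensor m n} {D : ∀ k, ConnTensor (s k) (m k)} {E : Type u}
    [NormedAddCommGroup E] [InnerProductSpace ℂ E] {B : Leg n → E →L[ℂ] E} (R : Realization C B)
    (S : ∀ k, Realization (D k) (R.A k)) : Nonempty (Realization (C.comp D) B) := by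
  obtain ⟨X, hX⟩ := HilbertTensor.exists_mapIsometry fun k => (S k).J
  let L : (Σ k, κ k) → Type u := fun l => (S l.1).H l.2
  let A : ∀ l : Σ k, κ k, Leg (s l.1 l.2) → L l →L[ℂ] L l := fun l => (S l.1).A l.2
  let W := HilbertTensor.sigmaEquiv L
  -- `X` is the tensor product of the embeddings of the subtrees. Each factor intertwines `R.A k`
  -- with the operators of `D k`, so `X` intertwines the two versions of `C`.
  have hop : ∀ e v, C.op (fun k => (D k).op (S k).A) e (X v) = X (C.op R.A e v) := by
    intro e v
    have : C.op (fun k => (D k).op (S k).A) e ∘L X.toContinuousLinearMap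
        = X.toContinuousLinearMap ∘L C.op R.A e := by
      refine HilbertTensor.clm_ext fun x => ?_
      have hz : ∀ z : ∀ k, Leg (m k),
          HilbertTensor.map (fun k => (D k).op (S k).A (z k))
            (HilbertTensor.map (fun k => (S k).J.toContinuousLinearMap) (HilbertTensor.tmul x))
          = HilbertTensor.map (fun k => (S k).J.toContinuousLinearMap)
            (HilbertTensor.map (fun k => R.A k (z k)) (HilbertTensor.tmul x)) := by
        intro z
        rw [HilbertTensor.map_tmul, HilbertTensor.map_tmul, HilbertTensor.map_tmul,
          HilbertTensor.map_tmul]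
        exact congrArg _ (funext fun k => (S k).op_apply _ _)
      rw [hX]
      change (∑ z, (C e z : ℂ) • HilbertTensor.map fun k => (D k).op (S k).A (z k)) _
        = HilbertTensor.map _ ((∑ z, (C e z : ℂ) • HilbertTensor.map fun k => R.A k (z k)) _)
      simp only [sum_apply, smul_apply, map_sum, map_smul]
      exact Finset.sum_congr rfl fun z _ => congrArg _ (hz z)
    exact congrArg (fun T => T v) this
  exact ⟨{
    H := L
    A := A
    J := W.symm.toLinearIsometry.comp (X.comp R.J)
    isMeasurement := fun l => (S l.1).isMeasurement l.2
    op_apply := fun e φ => by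
      apply W.injective
      have := ConnTensor.sigmaEquiv_op_comp (C := C) (B := D) A e (W.symm (X (R.J φ)))
      refine this.trans ?_
      change C.op (fun k => (D k).op (S k).A) e (W (W.symm (X (R.J φ)))) = W (W.symm (X (R.J _)))
      rw [W.apply_symm_apply, W.apply_symm_apply, hop, R.op_apply] }⟩

end Realization

/-- The realization provided by a connector complex. -/
noncomputable def ConnectorComplex.realization (D : ConnectorComplex.{u}) :
    Realization D.C D.M where
  H := D.H
  A := D.A
  J := ⟨(ContinuousLinearMap.adjoint D.V).toLinearMap, fun φ => by
    have h : D.V (ContinuousLinearMap.adjoint D.V φ) = φ :=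
      congrArg (fun T => T φ) D.coisometry
    refine (sq_eq_sq₀ (norm_nonneg _) (norm_nonneg _)).1 ?_
    rw [← inner_self_eq_norm_sq (𝕜 := ℂ), ← inner_self_eq_norm_sq (𝕜 := ℂ)]
    change RCLike.re ⟪ContinuousLinearMap.adjoint D.V φ, ContinuousLinearMap.adjoint D.V φ⟫_ℂ = _
    rw [ContinuousLinearMap.adjoint_inner_left, h]⟩
  isMeasurement := D.isMeasurement
  op_apply := (D.isConnector _ _ D.isMeasurement).apply_adjoint_of_isProjective D.V D.isProjective

/-! ### Quantum values of a connector -/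

section Quantum

variable {C : ConnTensor m n}

theorem ConnTensor.inner_dichotomic_op {H : ι → Type u} [∀ k, NormedAddCommGroup (H k)]
    [∀ k, InnerProductSpace ℂ (H k)] (A : ∀ k, Leg (m k) → H k →L[ℂ] H k) (y : Fin n)
    (ψ : HilbertTensor H) :
    ⟪ψ, dichotomic (C.op A) y ψ⟫_ℂ = ∑ b : ℤˣ, (((b : ℤ) : ℝ) : ℂ) * ∑ z, (C (b, y) z : ℂ) *
      ⟪ψ, HilbertTensor.map (fun k => A k (z k)) ψ⟫_ℂ := by
  rw [sum_intUnits]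
  simp only [dichotomic, op, sub_apply, sum_apply, smul_apply, inner_sub_right, inner_sum,
    inner_smul_right]
  simp [sub_eq_add_neg]

theorem IsMeasurement.abs_re_inner_dichotomic_le {m : ℕ} {E : Type u} [NormedAddCommGroup E]
    [InnerProductSpace ℂ E] {A : Leg m → E →L[ℂ] E} (hA : IsMeasurement A) (x : Fin m) {ψ : E}
    (hψ : ‖ψ‖ = 1) : |(⟪ψ, dichotomic A x ψ⟫_ℂ).re| ≤ 1 := by
  have h1 := (hA.isPositive (1, x)).re_inner_nonneg_right ψ
  have h2 := (hA.isPositive (-1, x)).re_inner_nonneg_right ψ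
  have h3 := congrArg (fun T => (⟪ψ, T ψ⟫_ℂ).re) (hA.sum_eq_one x)
  rw [sum_intUnits] at h3
  simp only [add_apply, inner_add_right, Complex.add_re, one_apply_eq_self,
    inner_self_eq_norm_sq_to_K, hψ] at h3
  simp only [dichotomic, sub_apply, inner_sub_right, Complex.sub_re]
  simp only [RCLike.re_to_complex] at h1 h2
  norm_num at h3
  rw [abs_le]
  constructor <;> linarith

/-- The value is a convex combination of expectations of the difference of the two effects of a
POVM. -/
theorem ConnTensor.IsConnector.abs_value_le_one (hC : IsConnector.{u} C) (y : Fin n)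
    {P : Behaviour m} (hP : IsQuantum.{u} P) : |C.value y P| ≤ 1 := by
  obtain ⟨H, _, _, _, A, p, ψ, hA, hp0, hp1, hψ, hP⟩ := hP
  have h : HasSum (fun j => p j * (⟪ψ j, dichotomic (C.op A) y (ψ j)⟫_ℂ).re) (C.value y P) := by
    have h1 : HasSum (fun j => ∑ b : ℤˣ, (((b : ℤ) : ℝ) : ℂ) * ∑ z, (C (b, y) z : ℂ) *
        (p j * ⟪ψ j, HilbertTensor.map (fun k => A k (z k)) (ψ j)⟫_ℂ)) (C.value y P : ℂ) := by
      simp only [value]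
      push_cast
      refine hasSum_sum fun b _ => HasSum.mul_left _ <| hasSum_sum fun z _ => (hP z).mul_left _
    have h2 := Complex.hasSum_re h1
    rw [Complex.ofReal_re] at h2
    refine h2.congr_fun fun j => ?_
    rw [← Complex.re_ofReal_mul, inner_dichotomic_op, Finset.mul_sum]
    simp only [Finset.mul_sum]
    congr 1
    refine Finset.sum_congr rfl fun b _ => Finset.sum_congr rfl fun z _ => by ring
  have hb := fun j => abs_le.1 ((hC H A hA).abs_re_inner_dichotomic_le y (hψ j))
  refine abs_le.2 ⟨?_, ?_⟩
  · refine hasSum_le (fun j => ?_) hp1.neg h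
    nlinarith [hp0 j, (hb j).1]
  · refine hasSum_le (fun j => ?_) h hp1
    nlinarith [hp0 j, (hb j).2]

/-- The behaviour of the parties that measure a pure state. -/
theorem ConnTensor.exists_isQuantum_value {H : ι → Type u} [∀ k, NormedAddCommGroup (H k)]
    [∀ k, InnerProductSpace ℂ (H k)] [∀ k, CompleteSpace (H k)]
    {A : ∀ k, Leg (m k) → H k →L[ℂ] H k} (hA : ∀ k, IsMeasurement (A k)) (y : Fin n)
    {ψ : HilbertTensor H} (hψ : ‖ψ‖ = 1) :
    ∃ P, IsQuantum.{u} P ∧ (C.value y P : ℂ) = ⟪ψ, dichotomic (C.op A) y ψ⟫_ℂ := by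
  have hreal : ∀ z : ∀ k, Leg (m k),
      ((⟪ψ, HilbertTensor.map (fun k => A k (z k)) ψ⟫_ℂ).re : ℂ)
        = ⟪ψ, HilbertTensor.map (fun k => A k (z k)) ψ⟫_ℂ := by
    intro z
    refine Complex.conj_eq_iff_re.1 ?_
    rw [inner_conj_symm, HilbertTensor.inner_map_left fun k => ((hA k).isPositive (z k)).1]
  refine ⟨fun z => (⟪ψ, HilbertTensor.map (fun k => A k (z k)) ψ⟫_ℂ).re,
    -- The pure state `ψ` as a mixture with all its weight on index `0`.
    ⟨H, inferInstance, inferInstance, inferInstance, A, Pi.single 0 1, fun _ => ψ, hA, fun j => ?_,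
      hasSum_pi_single 0 1, fun _ => hψ, fun z => ?_⟩, ?_⟩
  · by_cases hj : j = 0
    · subst hj; simp
    · simp [hj]
  · rw [hreal]
    have := hasSum_single (f := fun j => (((Pi.single 0 1 : ℕ → ℝ) j : ℝ) : ℂ) *
      ⟪ψ, HilbertTensor.map (fun k => A k (z k)) ψ⟫_ℂ) 0 (fun j hj => by simp [hj])
    simpa using this
  · rw [inner_dichotomic_op, value]
    push_cast
    simp only [hreal]

end Quantum

end Realizations

/-! ### Existence of the quantum-to-classical ratio -/

section ClassicalRatio

open scoped InnerProductSpace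

universe u

variable {ι : Type} [Fintype ι] [DecidableEq ι] {m : ι → ℕ} {n : ℕ} {C : ConnTensor m n}

namespace ConnTensor

/-- A leg without settings makes every sum over `∀ k, Leg (m k)` empty, so the output probabilities
would add up to `0`. Fair coins serve as test responses. -/
theorem IsConnector.settings_pos (hC : IsConnector.{u} C) (y : Fin n) (k : ι) : 0 < m k := by
  by_contra h
  have h0 : m k = 0 := by omega
  have : IsEmpty (∀ k, Leg (m k)) := ⟨fun z => absurd (z k).2.2 (by omega)⟩
  have h1 := (hC.eval (r := fun _ _ => 1 / 2) fun j =>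
    ⟨fun _ => by norm_num, fun x => by rw [sum_intUnits]; norm_num⟩).sum_eq_one y
  simp [ConnTensor.eval] at h1

/-- Coefficients of an XOR connector are values on classical behaviours. -/
theorem HasXORCoeffs.exists_isResponse {c : Fin n → (∀ k, Fin (m k)) → ℝ}
    (hc : HasXORCoeffs.{u} C c) (y : Fin n) (x : ∀ k, Fin (m k)) (i : ι) (t : ℝ)
    (ht : |t| ≤ 1) : ∃ r : ∀ k, Leg (m k) → ℝ, (∀ k, IsResponse (r k)) ∧
      meanOutcome (C.eval r) y = t * c y x := by
  -- Each party has mean zero off the setting `x k`, so only the monomial of `x` survives; party `i`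
  -- alone carries the factor `t`.
  have := fun k => exists_isResponse_meanOutcome
    (fun x' => if x' = x k then (if k = i then t else 1) else 0) (by
      intro x'; split_ifs <;> simp [ht])
  choose r hr hm using this
  refine ⟨r, hr, ?_⟩
  rw [hc.meanOutcome_eval hr, Finset.sum_eq_single x]
  · simp only [hm, if_true]
    rw [Finset.prod_ite_eq' Finset.univ i fun _ => t]
    simp [mul_comm]
  · intro x' _ hx'
    obtain ⟨k, hk⟩ := Function.ne_iff.1 hx'
    rw [Finset.prod_eq_zero (Finset.mem_univ k) (by simp [hm, hk]), mul_zero]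
  · simp

/-- If `C_y[A] ≠ 0` for some measurements `A`, then `C_y` takes positive classical values. -/
theorem exists_isClassical_value_pos (hX : IsXOR.{u} C) (i : ι) {y : Fin n}
    {H : ι → Type u} [∀ k, NormedAddCommGroup (H k)] [∀ k, InnerProductSpace ℂ (H k)]
    [∀ k, CompleteSpace (H k)] {A : ∀ k, Leg (m k) → H k →L[ℂ] H k}
    (hA : ∀ k, IsMeasurement (A k)) (hne : dichotomic (C.op A) y ≠ 0) :
    ∃ P, IsClassical P ∧ 0 < C.value y P := by
  obtain ⟨c, hc⟩ := hX
  obtain ⟨x, hx⟩ : ∃ x, c y x ≠ 0 := by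
    by_contra! h
    exact hne (by rw [hc H A hA y]; simp [h])
  -- The factor `sign (c y x)` turns the value into `|c y x|`.
  obtain ⟨r, hr, hv⟩ := HasXORCoeffs.exists_isResponse hc y x i (SignType.sign (c y x) : ℝ) (by
    rcases lt_or_gt_of_ne hx with h | h <;> simp [h])
  refine ⟨_, isClassical_prod hr, ?_⟩
  rw [value_prod, hv, sign_mul_self]
  exact abs_pos.2 hx

/-- Flipping the outcomes of one party flips the output. -/
theorem IsXOR.exists_isMeasurement_neg (hX : IsXOR.{u} C) (i : ι) (y : Fin n)
    {H : ι → Type u} [∀ k, NormedAddCommGroup (H k)] [∀ k, InnerProductSpace ℂ (H k)]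
    [∀ k, CompleteSpace (H k)] {A : ∀ k, Leg (m k) → H k →L[ℂ] H k}
    (hA : ∀ k, IsMeasurement (A k)) :
    ∃ A' : ∀ k, Leg (m k) → H k →L[ℂ] H k, (∀ k, IsMeasurement (A' k)) ∧
      dichotomic (C.op A') y = -dichotomic (C.op A) y := by
  obtain ⟨c, hc⟩ := hX
  let σ : ι → ℤˣ := fun k => if k = i then -1 else 1
  have hA' : ∀ k, IsMeasurement fun e : Leg (m k) => A k (σ k * e.1, e.2) := by
    intro k
    refine ⟨fun e => (hA k).isPositive _, fun x => ?_⟩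
    rw [← (hA k).sum_eq_one x]
    exact Fintype.sum_equiv (Equiv.mulLeft (σ k)) _ _ fun a => rfl
  refine ⟨_, hA', ?_⟩
  have hd : ∀ k x, dichotomic (fun e : Leg (m k) => A k (σ k * e.1, e.2)) x
      = (if k = i then (-1 : ℂ) else 1) • dichotomic (A k) x := by
    intro k x
    by_cases hk : k = i <;> simp [dichotomic, σ, hk]
  rw [hc H _ hA', hc H A hA, ← Finset.sum_neg_distrib]
  refine Finset.sum_congr rfl fun x _ => ?_
  simp only [hd, HilbertTensor.map_smul_univ]
  rw [Finset.prod_ite_eq' Finset.univ i fun _ => (-1 : ℂ)]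
  simp

theorem IsConnector.one_mem_classicalFactors (hC : IsConnector.{u} C) :
    (1 : ℝ) ∈ C.classicalFactors := by
  intro y P hP
  have := C.abs_value_le_of_isClassical y (B := 1)
    (fun r hr => (hC.eval hr).abs_meanOutcome_le y) hP
  simpa using abs_le.1 this

/-- The admissible factors are an intersection of closed conditions, contain `1`, and are bounded
above by the inverse of one positive classical value. -/
theorem isGreatest_gamma (hC : IsConnector.{u} C) {y : Fin n} {P : Behaviour m}
    (hP : IsClassical P) (hv : 0 < C.value y P) :
    IsGreatest C.classicalFactors C.gamma := by
  have hbdd : BddAbove C.classicalFactors :=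
    ⟨1 / C.value y P, fun g hg => (le_div_iff₀ hv).2 (hg y P hP).2⟩
  have hclosed : IsClosed C.classicalFactors := by
    have e : C.classicalFactors = ⋂ y, ⋂ P, ⋂ _ : IsClassical P,
        (fun g => g * C.value y P) ⁻¹' Set.Icc (-1) 1 := by
      ext g; simp [classicalFactors]
    rw [e]
    exact isClosed_iInter fun y => isClosed_iInter fun P => isClosed_iInter fun _ =>
      isClosed_Icc.preimage (by fun_prop)
  exact hclosed.isGreatest_csSup ⟨1, hC.one_mem_classicalFactors⟩ hbdd

end ConnTensor

namespace XORComplex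

variable (D : XORComplex.{u})

/-- Two equal projectors with sum `1` must vanish, which is impossible on a nonzero space. -/
theorem dichotomic_M_ne_zero (y : Fin D.n) : dichotomic D.M y ≠ 0 := by
  intro h
  have h1 : D.M (1, y) = D.M (-1, y) := sub_eq_zero.1 h
  have hs := D.isProjective.sum_eq_one y
  rw [sum_intUnits] at hs
  change D.M (1, y) + D.M (-1, y) = 1 at hs
  have hi : D.M (1, y) * D.M (1, y) = D.M (1, y) :=
    (D.isProjective.isStarProjection (1, y)).isIdempotentElem
  rw [← h1] at hs
  have h2 : D.M (1, y) = 0 := by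
    have := congrArg (fun T => D.M (1, y) * T) hs
    simpa [mul_add, hi] using this
  rw [h2, add_zero] at hs
  exact zero_ne_one hs

theorem exists_isClassical_value_pos (y : Fin D.n) :
    ∃ P, IsClassical P ∧ 0 < D.C.value y P := by
  refine ConnTensor.exists_isClassical_value_pos D.isXOR ⟨0, D.q_pos⟩ D.isMeasurement fun h => ?_
  refine D.dichotomic_M_ne_zero y ?_
  ext φ
  have h1 := congrArg (fun T => D.V (T (ContinuousLinearMap.adjoint D.V φ))) h
  simpa [dichotomic, ConnectorComplex.M] using h1

/-- The setting `y` is essential: without output settings every real number is an admissible factor,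
and `gamma` is the default value `0` of `sSup`. -/
theorem isGreatest_gamma (y : Fin D.n) : IsGreatest D.C.classicalFactors D.C.gamma := by
  obtain ⟨P, hP, hv⟩ := D.exists_isClassical_value_pos y
  exact ConnTensor.isGreatest_gamma D.isConnector hP hv

theorem one_le_gamma (y : Fin D.n) : 1 ≤ D.C.gamma :=
  (D.isGreatest_gamma y).2 D.isConnector.one_mem_classicalFactors

end XORComplex

end ClassicalRatio

/-! ### Induction over the tree -/

section NetworkValues

open scoped InnerProductSpace

universe u

namespace ConnTensor

/-- The identity tensor of an open leg. -/
def idTensor (n : ℕ) : ConnTensor (fun _ : Unit => n) n :=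
  fun e z => (1 : Matrix (Leg n) (Leg n) ℝ) e (z ())

theorem sum_idTensor_smul {n : ℕ} {M : Type*} [AddCommGroup M] [Module ℝ M] (e : Leg n)
    (f : (∀ _ : Unit, Leg n) → M) : ∑ z, idTensor n e z • f z = f fun _ => e := by
  rw [Finset.sum_eq_single fun _ => e]
  · simp [idTensor]
  · intro z _ hz
    have : e ≠ z () := fun h => hz (funext fun _ => h.symm)
    simp [idTensor, Matrix.one_apply_ne this]
  · simp

theorem eval_idTensor {n : ℕ} (r : ∀ _ : Unit, Leg n → ℝ) : (idTensor n).eval r = r () := by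
  funext e
  have := sum_idTensor_smul e fun z => ∏ k, r k (z k)
  simpa [eval] using this

variable {n : ℕ} {H : Unit → Type u} [∀ k, NormedAddCommGroup (H k)]
  [∀ k, InnerProductSpace ℂ (H k)]

theorem op_idTensor (A : ∀ k : Unit, Leg n → H k →L[ℂ] H k) (e : Leg n) :
    (idTensor n).op A e = HilbertTensor.map fun k => A k e :=
  sum_idTensor_smul e fun z => HilbertTensor.map fun k => A k (z k)

theorem isConnector_idTensor : IsConnector.{u} (idTensor n) := by
  intro H _ _ _ A hA
  obtain ⟨S, hS⟩ := HilbertTensor.exists_unitEquiv H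
  refine (hA ()).of_unitary S.symm fun e u => ?_
  obtain ⟨x, rfl⟩ := S.surjective u
  rw [S.symm_apply_apply, S.symm_apply_eq, op_idTensor, hS, hS, HilbertTensor.map_tmul]

theorem isXOR_idTensor : IsXOR.{u} (idTensor n) := by
  refine ⟨fun y x => if x () = y then 1 else 0, fun H _ _ _ A hA y => ?_⟩
  rw [Finset.sum_eq_single fun _ => y]
  · refine HilbertTensor.clm_ext fun x => HilbertTensor.ext_inner_tmul fun z => ?_
    simp [dichotomic, op_idTensor, HilbertTensor.map_tmul, HilbertTensor.inner_tmul,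
      inner_sub_right]
  · intro x _ hx
    have : x () ≠ y := fun h => hx (funext fun _ => h)
    simp [this]
  · simp

end ConnTensor

/-- An open leg realizes every system of measurements. -/
theorem nonempty_realization_idTensor {n : ℕ} {E : Type u} [NormedAddCommGroup E]
    [InnerProductSpace ℂ E] [CompleteSpace E] {B : Leg n → E →L[ℂ] E} (hB : IsMeasurement B) :
    Nonempty (Realization (ConnTensor.idTensor n) B) := by
  obtain ⟨S, hS⟩ := HilbertTensor.exists_unitEquiv fun _ => E
  exact ⟨{
    H := fun _ => E
    A := fun _ => B
    J := S.toLinearIsometry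
    isMeasurement := fun _ => hB
    op_apply := fun e φ => by
      rw [ConnTensor.op_idTensor]
      simp [hS, HilbertTensor.map_tmul] }⟩

theorem ConnectorComplex.isMeasurement_M (D : ConnectorComplex.{u}) : IsMeasurement D.M where
  isPositive e := ((D.isConnector _ _ D.isMeasurement).isPositive e).conj_adjoint D.V
  sum_eq_one := D.isProjective.sum_eq_one

/-- Every outcome that occurs in a projective measurement is attained on a unit vector. -/
theorem IsProjectiveMeasurement.exists_dichotomic_eq_smul {m : ℕ} {E : Type u}
    [NormedAddCommGroup E] [InnerProductSpace ℂ E] [CompleteSpace E] [Nontrivial E]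
    {B : Leg m → E →L[ℂ] E} (hB : IsProjectiveMeasurement B) (y : Fin m) :
    ∃ (φ : E) (t : ℂ), ‖φ‖ = 1 ∧ (t = 1 ∨ t = -1) ∧ dichotomic B y φ = t • φ := by
  have hs : ∀ v, B (1, y) v + B (-1, y) v = v := fun v => by
    have := congrArg (fun T => T v) (hB.sum_eq_one y)
    rwa [sum_intUnits] at this
  have hi : ∀ a v, B (a, y) (B (a, y) v) = B (a, y) v := fun a v =>
    congrArg (fun T => T v) (hB.isStarProjection (a, y)).isIdempotentElem
  have key : ∃ (φ : E) (t : ℂ), φ ≠ 0 ∧ (t = 1 ∨ t = -1) ∧ dichotomic B y φ = t • φ := by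
    obtain ⟨v, hv⟩ := exists_ne (0 : E)
    -- Either `v` already lies in the range of the `-1` projector, or its component `B (1, y) v` is
    -- an eigenvector for `1`.
    by_cases h : B (1, y) v = 0
    · have h1 := hs v
      rw [h, zero_add] at h1
      refine ⟨v, -1, hv, Or.inr rfl, ?_⟩
      simp [dichotomic, h, h1]
    · have h1 := hs (B (1, y) v)
      rw [hi, add_eq_left] at h1
      refine ⟨_, 1, h, Or.inl rfl, ?_⟩
      simp [dichotomic, h1, hi]
  obtain ⟨φ, t, hφ, ht, h⟩ := key
  refine ⟨((‖φ‖⁻¹ : ℝ) : ℂ) • φ, t, ?_, ht, ?_⟩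
  · rw [norm_smul, Complex.norm_real, norm_inv, norm_norm, inv_mul_cancel₀ (norm_ne_zero_iff.2 hφ)]
  · rw [map_smul, h, smul_comm]

namespace Network

theorem isConnector_tensor {n : ℕ} (T : Network.{u} n) : ConnTensor.IsConnector.{u} T.tensor := by
  induction T with
  | wire n => exact ConnTensor.isConnector_idTensor
  | node D child ih => exact D.isConnector.comp ih

theorem isXOR_tensor {n : ℕ} (T : Network.{u} n) : ConnTensor.IsXOR.{u} T.tensor := by
  induction T with
  | wire n => exact ConnTensor.isXOR_idTensor
  | node D child ih =>
    choose b hb using ih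
    obtain ⟨c, hc⟩ := D.isXOR
    exact ⟨_, ConnTensor.HasXORCoeffs.comp hc hb fun k => (child k).isConnector_tensor⟩

theorem nonempty_leaf {n : ℕ} (T : Network.{u} n) : Nonempty T.Leaf := by
  induction T with
  | wire n => exact ⟨()⟩
  | node D child ih => exact ⟨⟨⟨0, D.q_pos⟩, (ih _).some⟩⟩

/-- Congruence is exactly the hypothesis needed to recurse: the subtree at leg `k` realizes the
measurements `D.A k` that the realization of `D` asks for. The final unitary comes from `OutputIs`;
the space `E` varies in the induction. -/
theorem nonempty_realization {n : ℕ} (T : Network.{u} n) (hT : T.IsCongruent) {E : Type u}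
    [NormedAddCommGroup E] [InnerProductSpace ℂ E] [CompleteSpace E] {B : Leg n → E →L[ℂ] E}
    (hB : IsMeasurement B) (h : T.OutputIs B) : Nonempty (Realization T.tensor B) := by
  induction T generalizing E with
  | wire n => exact nonempty_realization_idTensor hB
  | node D child ih =>
    have S := fun k => ih k (hT k).2 (D.isMeasurement k) (hT k).1
    obtain ⟨R⟩ := Realization.nonempty_comp D.realization fun k => (S k).some
    obtain ⟨U, hU⟩ := h
    exact ⟨R.ofUnitary U hU⟩

/-- A congruent network attains an extremal value on a pure state. -/
theorem exists_dichotomic_op_eq_smul {n : ℕ} (T : Network.{u} n) (hT : T.IsCongruent)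
    (y : Fin n) :
    ∃ (H : T.Leaf → Type u) (_ : ∀ k, NormedAddCommGroup (H k))
      (_ : ∀ k, InnerProductSpace ℂ (H k)) (_ : ∀ k, CompleteSpace (H k))
      (A : ∀ k, Leg (T.settings k) → H k →L[ℂ] H k) (ψ : HilbertTensor H) (t : ℂ),
      (∀ k, IsMeasurement (A k)) ∧ ‖ψ‖ = 1 ∧ (t = 1 ∨ t = -1) ∧
      dichotomic (T.tensor.op A) y ψ = t • ψ := by
  obtain ⟨E, _, _, _, B, φ, t, hB, hT', hφ, ht, h⟩ : ∃ (E : Type u) (_ : NormedAddCommGroup E)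
      (_ : InnerProductSpace ℂ E) (_ : CompleteSpace E) (B : Leg n → E →L[ℂ] E) (φ : E) (t : ℂ),
      IsMeasurement B ∧ T.OutputIs B ∧ ‖φ‖ = 1 ∧ (t = 1 ∨ t = -1) ∧
      dichotomic B y φ = t • φ := by
    cases T with
    | wire n =>
      -- A bare wire has no root complex; the party that always answers `+1` is used instead.
      obtain ⟨r, hr, hm⟩ := exists_isResponse_meanOutcome (fun _ : Fin n => (1 : ℝ)) (by simp)
      refine ⟨ScalarSpace.{u}, inferInstance, inferInstance, inferInstance, _,
        EuclideanSpace.single PUnit.unit 1, 1, hr.isMeasurement, trivial, by simp, Or.inl rfl, ?_⟩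
      have h1 := congrFun hm y
      rw [meanOutcome] at h1
      rw [dichotomic, ← sub_smul, ← Complex.ofReal_sub, h1]
      simp
    | node D child =>
      obtain ⟨φ, t, hφ, ht, h⟩ := D.isProjective.exists_dichotomic_eq_smul y
      exact ⟨D.Hout, inferInstance, inferInstance, inferInstance, D.M, φ, t, D.isMeasurement_M,
        ⟨LinearIsometryEquiv.refl ℂ D.Hout, fun _ _ => rfl⟩, hφ, ht, h⟩
  obtain ⟨R⟩ := T.nonempty_realization hT hB hT'
  refine ⟨R.H, inferInstance, inferInstance, inferInstance, R.A, R.J φ, t, R.isMeasurement,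
    by rw [R.J.norm_map, hφ], ht, ?_⟩
  rw [dichotomic, sub_apply, R.op_apply, R.op_apply, ← map_sub, ← sub_apply, ← dichotomic, h,
    map_smul]

/-- The eigenvalue found may have either sign; flipping one party's outcomes on the same state
supplies the other. -/
theorem exists_isQuantum_value {n : ℕ} (T : Network.{u} n) (hT : T.IsCongruent) (y : Fin n) :
    (∃ P, IsQuantum.{u} P ∧ T.tensor.value y P = -1) ∧
    (∃ P, IsQuantum.{u} P ∧ T.tensor.value y P = 1) := by
  obtain ⟨H, _, _, _, A, ψ, t, hA, hψ, ht, h⟩ := T.exists_dichotomic_op_eq_smul hT y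
  obtain ⟨A', hA', h'⟩ := T.isXOR_tensor.exists_isMeasurement_neg T.nonempty_leaf.some y hA
  obtain ⟨P, hP, hv⟩ := ConnTensor.exists_isQuantum_value (C := T.tensor) hA y hψ
  obtain ⟨P', hP', hv'⟩ := ConnTensor.exists_isQuantum_value (C := T.tensor) hA' y hψ
  rw [h, inner_smul_right, inner_self_eq_norm_sq_to_K, hψ] at hv
  rw [h', neg_apply, h, inner_neg_right, inner_smul_right, inner_self_eq_norm_sq_to_K, hψ] at hv'
  rcases ht with rfl | rfl
  · refine ⟨⟨P', hP', ?_⟩, ⟨P, hP, ?_⟩⟩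
    · exact Complex.ofReal_injective (hv'.trans (by simp))
    · exact Complex.ofReal_injective (hv.trans (by simp))
  · refine ⟨⟨P, hP, ?_⟩, ⟨P', hP', ?_⟩⟩
    · exact Complex.ofReal_injective (hv.trans (by simp))
    · exact Complex.ofReal_injective (hv'.trans (by simp))

/-- The eigenvector with eigenvalue `±1` shows that the contracted XOR functional is not identically
zero. This makes the classical maximum positive, so that the final quotient is meaningful. -/
theorem exists_isClassical_value_pos {n : ℕ} (T : Network.{u} n) (hT : T.IsCongruent)
    (y : Fin n) : ∃ P, IsClassical P ∧ 0 < T.tensor.value y P := by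
  obtain ⟨H, _, _, _, A, ψ, t, hA, hψ, ht, h⟩ := T.exists_dichotomic_op_eq_smul hT y
  refine ConnTensor.exists_isClassical_value_pos T.isXOR_tensor T.nonempty_leaf.some hA
    fun h0 => ?_
  rw [h0, zero_apply] at h
  have hψ0 : ψ ≠ 0 := by rintro rfl; simp at hψ
  rcases ht with rfl | rfl <;> simp [hψ0] at h
  exact hψ0 h.symm

/-- A setting at the root forces a setting on each input leg, hence on the output of each child, and
so on down the tree. -/
theorem nonempty_settings_complexAt {n : ℕ} (T : Network.{u} n) (y : Fin n) (v : T.Node) :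
    Nonempty (Fin (T.complexAt v).n) := by
  induction T with
  | wire n => exact v.elim
  | node D child ih =>
    match v with
    | none => exact ⟨y⟩
    | some ⟨k, w⟩ => exact ih k ⟨0, D.isConnector.settings_pos y k⟩ w

theorem bigGamma_node (D : XORComplex.{u}) (child : ∀ k : Fin D.q, Network (D.m k)) :
    (node D child).bigGamma = D.C.gamma * ∏ k, (child k).bigGamma := by
  have h : (node D child).bigGamma = ∏ v : Option (Σ k : Fin D.q, (child k).Node),
    ((node D child).complexAt v).C.gamma := rfl
  rw [h, Fintype.prod_option, Fintype.prod_sigma]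
  rfl

theorem bigGamma_pos {n : ℕ} (T : Network.{u} n) (y : Fin n) : 0 < T.bigGamma :=
  Finset.prod_pos fun v _ => zero_lt_one.trans_le
    ((T.complexAt v).one_le_gamma (T.nonempty_settings_complexAt y v).some)

theorem abs_meanOutcome_eval_le {n : ℕ} (T : Network.{u} n) (y : Fin n)
    {r : ∀ l, Leg (T.settings l) → ℝ} (hr : ∀ l, IsResponse (r l)) :
    |meanOutcome (T.tensor.eval r) y| ≤ 1 / T.bigGamma := by
  induction T with
  | wire n =>
    have h1 : (wire.{u} n).bigGamma = 1 := Finset.prod_empty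
    have h2 : (wire.{u} n).tensor.eval r = r () := ConnTensor.eval_idTensor r
    rw [h1, h2, one_div_one]
    exact (hr ()).abs_meanOutcome_le y
  | node D child ih =>
    have hpos : ∀ k, 0 < (child k).bigGamma := fun k =>
      (child k).bigGamma_pos ⟨0, D.isConnector.settings_pos y k⟩
    let g : ∀ k, Leg (D.m k) → ℝ := fun k => (child k).tensor.eval fun l => r ⟨k, l⟩
    have hg : ∀ k, IsResponse (g k) := fun k =>
      (child k).isConnector_tensor.eval fun l => hr ⟨k, l⟩
    have hgx : ∀ k x, |meanOutcome (g k) x| ≤ 1 / (child k).bigGamma := fun k x =>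
      ih k x fun l => hr ⟨k, l⟩
    have he : (node D child).tensor.eval r = D.C.eval g :=
      ConnTensor.eval_comp (C := D.C) (B := fun k => (child k).tensor) r
    -- By induction the means from subtree `k` lie in `[-1/Γ_k, 1/Γ_k]`, so they stay admissible
    -- after multiplication by `Γ_k`.
    have := fun k => exists_isResponse_meanOutcome
      (fun x => (child k).bigGamma * meanOutcome (g k) x) (fun x => by
        rw [abs_mul, abs_of_pos (hpos k), mul_comm]
        exact (le_div_iff₀ (hpos k)).1 (hgx k x))
    choose r' hr' hm using this
    obtain ⟨c, hc⟩ := D.isXOR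
    have hc : ConnTensor.HasXORCoeffs.{u} D.C c := hc
    have hscale : meanOutcome (D.C.eval r') y
        = (∏ k, (child k).bigGamma) * meanOutcome (D.C.eval g) y := by
      rw [hc.meanOutcome_eval hr', hc.meanOutcome_eval hg, Finset.mul_sum]
      refine Finset.sum_congr rfl fun x _ => ?_
      simp only [hm, Finset.prod_mul_distrib]
      ring
    -- The defining bound of `γ` at the root is applied to the rescaled responses rather than to the
    -- original ones.
    have hb := (D.isGreatest_gamma y).1 y _ (isClassical_prod hr')
    rw [ConnTensor.value_prod, hscale, ← mul_assoc, ← bigGamma_node] at hb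
    have hG := (node D child).bigGamma_pos y
    rw [he, le_div_iff₀ hG, mul_comm]
    calc _ = |(node D child).bigGamma * meanOutcome (D.C.eval g) y| := by
          rw [abs_mul, abs_of_pos hG]
      _ ≤ 1 := abs_le.2 hb

/-- Each complex replaces one open leg by at most `q`, a gain of at most `q - 1`, starting from a
single wire. -/
theorem card_leaf_le {n : ℕ} (T : Network.{u} n) {q : ℕ} (hq : 1 ≤ q)
    (h : ∀ v, (T.complexAt v).q ≤ q) :
    Fintype.card T.Leaf ≤ 1 + Fintype.card T.Node * (q - 1) := by
  induction T with
  | wire n => exact le_of_eq_of_le (Fintype.card_unit) (Nat.le_add_right _ _)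
  | node D child ih =>
    have h1 : Fintype.card (node D child).Leaf = ∑ k, Fintype.card (child k).Leaf :=
      Fintype.card_sigma
    have h2 : Fintype.card (node D child).Node = (∑ k, Fintype.card (child k).Node) + 1 :=
      Fintype.card_option.trans (congrArg (· + 1) Fintype.card_sigma)
    have h3 : D.q ≤ q := h none
    have h4 : ∑ k, Fintype.card (child k).Leaf ≤ ∑ k, (1 + Fintype.card (child k).Node * (q - 1)) :=
      Finset.sum_le_sum fun k _ => ih k fun v => h (some ⟨k, v⟩)
    rw [Finset.sum_add_distrib, ← Finset.sum_mul] at h4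
    simp only [Finset.sum_const, Finset.card_univ, Fintype.card_fin, smul_eq_mul, mul_one] at h4
    rw [h1, h2, add_mul]
    omega

end Network

end NetworkValues

-- The proposition and its corollary

universe u

theorem mainTheorem2 {n : ℕ} (T : Network.{u} n) (hT : T.IsCongruent) (y : Fin n) :
    (∀ P : Behaviour T.settings, IsQuantum.{u} P →
      -1 ≤ T.tensor.value y P ∧ T.tensor.value y P ≤ 1) ∧
    (∃ P : Behaviour T.settings, IsQuantum.{u} P ∧ T.tensor.value y P = -1) ∧
    (∃ P : Behaviour T.settings, IsQuantum.{u} P ∧ T.tensor.value y P = 1) ∧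
    (∀ v : T.Node, IsGreatest (T.complexAt v).C.classicalFactors (T.complexAt v).C.gamma) ∧
    (∀ P : Behaviour T.settings, IsClassical P →
      -(1 / T.bigGamma) ≤ T.tensor.value y P ∧ T.tensor.value y P ≤ 1 / T.bigGamma) ∧
    (∀ γ₀ : ℝ, 1 < γ₀ → (∀ v : T.Node, γ₀ ≤ (T.complexAt v).C.gamma) →
      T.tensor.classicalMax y ≤ (γ₀ ^ Fintype.card T.Node)⁻¹ ∧
      γ₀ ^ Fintype.card T.Node ≤
        ConnTensor.quantumMax.{u} T.tensor y / T.tensor.classicalMax y ∧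
      ∀ qbar : ℕ, 2 ≤ qbar → (∀ v : T.Node, (T.complexAt v).q ≤ qbar) →
        ⌈((Fintype.card T.Leaf : ℝ) - 1) / ((qbar : ℝ) - 1)⌉ ≤ (Fintype.card T.Node : ℤ) ∧
        γ₀ ^ (((Fintype.card T.Leaf : ℝ) - 1) / ((qbar : ℝ) - 1)) ≤
          ConnTensor.quantumMax.{u} T.tensor y / T.tensor.classicalMax y) := by
  have hquant : ∀ P : Behaviour T.settings, IsQuantum.{u} P →
      -1 ≤ T.tensor.value y P ∧ T.tensor.value y P ≤ 1 := fun P hP =>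
    abs_le.1 (T.isConnector_tensor.abs_value_le_one y hP)
  have hclass : ∀ P : Behaviour T.settings, IsClassical P →
      |T.tensor.value y P| ≤ 1 / T.bigGamma := fun P hP =>
    T.tensor.abs_value_le_of_isClassical y (fun r hr => T.abs_meanOutcome_eval_le y hr) hP
  obtain ⟨hneg, hpos⟩ := T.exists_isQuantum_value hT y
  refine ⟨hquant, hneg, hpos,
    fun v => (T.complexAt v).isGreatest_gamma (T.nonempty_settings_complexAt y v).some,
    fun P hP => abs_le.1 (hclass P hP), fun γ₀ hγ₀ hγ => ?_⟩
  obtain ⟨P₀, hP₀, hv₀⟩ := T.exists_isClassical_value_pos hT y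
  have hγpos : 0 < γ₀ := zero_lt_one.trans hγ₀
  have hΓ : γ₀ ^ Fintype.card T.Node ≤ T.bigGamma := by
    rw [← Finset.card_univ, ← Finset.prod_const]
    exact Finset.prod_le_prod (fun _ _ => hγpos.le) fun v _ => hγ v
  have hmax : T.tensor.classicalMax y ≤ (γ₀ ^ Fintype.card T.Node)⁻¹ := by
    refine csSup_le ⟨_, P₀, hP₀, rfl⟩ ?_
    rintro _ ⟨P, hP, rfl⟩
    refine (le_abs_self _).trans ((hclass P hP).trans ?_)
    rw [one_div]
    exact inv_anti₀ (pow_pos hγpos _) hΓ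
  -- The classical bound is needed here too: a real `sSup` dominates its elements only if the set is
  -- bounded above. Positivity then allows the inequality for the maximum to be inverted.
  have hmaxpos : 0 < T.tensor.classicalMax y := by
    refine hv₀.trans_le (le_csSup ⟨1 / T.bigGamma, ?_⟩ ⟨P₀, hP₀, rfl⟩)
    rintro _ ⟨P, hP, rfl⟩
    exact (le_abs_self _).trans (hclass P hP)
  have hq : ConnTensor.quantumMax.{u} T.tensor y = 1 := by
    refine IsGreatest.csSup_eq ⟨hpos, ?_⟩
    rintro _ ⟨P, hP, rfl⟩
    exact (hquant P hP).2
  have hratio : γ₀ ^ Fintype.card T.Node ≤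
      ConnTensor.quantumMax.{u} T.tensor y / T.tensor.classicalMax y := by
    rw [hq, one_div]
    exact (le_inv_comm₀ (pow_pos hγpos _) hmaxpos).2 hmax
  refine ⟨hmax, hratio, fun qbar hqbar hqv => ?_⟩
  have hcard : ((Fintype.card T.Leaf : ℝ) - 1) / ((qbar : ℝ) - 1) ≤ Fintype.card T.Node := by
    have h2 : (2 : ℝ) ≤ qbar := by exact_mod_cast hqbar
    have h1 : (Fintype.card T.Leaf : ℝ) ≤ 1 + Fintype.card T.Node * ((qbar : ℝ) - 1) := by
      have := T.card_leaf_le (by omega : 1 ≤ qbar) hqv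
      have : (Fintype.card T.Leaf : ℝ) ≤ ((1 + Fintype.card T.Node * (qbar - 1) : ℕ) : ℝ) := by
        exact_mod_cast this
      rwa [Nat.cast_add, Nat.cast_mul, Nat.cast_sub (by omega), Nat.cast_one] at this
    rw [div_le_iff₀ (by linarith)]
    linarith
  refine ⟨Int.ceil_le.2 (by exact_mod_cast hcard), le_trans ?_ hratio⟩
  -- The exponents are compared as reals, which needs only `1 ≤ γ₀`.
  rw [← Real.rpow_natCast]
  exact Real.rpow_le_rpow_of_exponent_le hγ₀.le hcard
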